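/- Let $\pi$ be a probability measure on a measurable space $\mathsf{X}$, let $q$ be a Markov kernel on $\mathsf{X}$ (the proposal), and let $$r(x,y)=\frac{\pi(\mathrm{d}y)\,q(y,\mathrm{d}x)}{\pi(\mathrm{d}x)\,q(x,\mathrm{d}y)}$$ be a measurable version of the Radon--Nikodym derivative (the density of the absolutely continuous part of the numerator with respect to the denominator). The marginal Metropolis--Hastings kernel is $$P(x,\mathrm{d}y)=\min\{1,r(x,y)\}\,q(x,\mathrm{d}y)+\rho(x)\,\delta_x(\mathrm{d}y),\qquad \rho(x)=1-\int\min\{1,r(x,y)\}\,q(x,\mathrm{d}y).$$ Let $\mathsf{W}$ be a Borel subset of $[0,\infty)$. For every $N\in\mathbb{N}$ let $Q^N_x(\mathrm{d}w)$ be a Markov kernel from $\mathsf{X}$ to $\mathsf{W}$ with $\int w\,Q_x^N(\mathrm{d}w)=1$ for all $x\in\mathsf{X}$. Put $\tilde\pi_N(\mathrm{d}x,\mathrm{d}w)=\pi(\mathrm{d}x)\,Q^N_x(\mathrm{d}w)\,w$, and let $$\tilde P_N(x,w;\mathrm{d}y,\mathrm{d}u)=\min\Big\{1,r(x,y)\frac{u}{w}\Big\}\,q(x,\mathrm{d}y)\,Q^N_y(\mathrm{d}u)+\tilde\rho_N(x,w)\,\delta_{(x,w)}(\mathrm{d}y,\mathrm{d}u)$$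 be the pseudo-marginal kernel on $\mathsf{X}\times\mathsf{W}$, where $\tilde\rho_N(x,w)$ is the rejection probability, which makes the total mass $1$. For a Markov kernel $\Pi$ with invariant distribution $\mu$, the associated stationary Markov chain $(X_k)_{k\ge0}$ (so $X_0\sim\mu$) and a function $f$ with $\mu(f^2)<\infty$, define $$\mathrm{var}(f,\Pi)=\lim_{n\to\infty}\frac1n\,\mathbb{E}\Big(\sum_{k=1}^n\big[f(X_k)-\mu(f)\big]\Big)^2\in[0,\infty],\qquad \tau(f,\Pi)=1+2\sum_{k=1}^\infty\frac{\mathbb{E}[f(X_0)f(X_k)]-\mu(f)^2}{\mathrm{var}_\mu(f)},$$ where infinite series are limits of their partial sums (in the degenerate case $\mathrm{var}_\mu(f)=0$ we put $\tau(f,\Pi)=1$). Write $\mathrm{var}(g,\tilde P_N)$ for the asymptotic variance of the function $(x,w)\mapsto g(x)$ under $\tilde P_N$. **Theorem.** Let $g:\mathsf{X}\to\mathbb{R}$ be measurable with $\pi(|g|^{2+\delta})<\infty$ for some $\delta>0$, and put $\bar g=g-\pi(g)$. Assume: 1. $\tau(g,P)$ is well defined and finite; 2. there is $N_0<\infty$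 such that, for the Markov chain $(\tilde X^N_k,\tilde W^N_k)_{k\ge0}$ with initial distribution $\tilde\pi_N$ and kernel $\tilde P_N$, the series $\sum_{k}\mathbb{E}[\bar g(\tilde X^N_0)\bar g(\tilde X^N_k)]$ converges for every $N\ge N_0$ and $$\lim_{n\to\infty}\ \sup_{N\ge N_0}\Big|\sum_{k=n}^\infty\mathbb{E}\big[\bar g(\tilde X^N_0)\,\bar g(\tilde X^N_k)\big]\Big|=0;$$ 3. $\displaystyle\lim_{N\to\infty}\int Q^N_x(\mathrm{d}w)\,|1-w|=0$ for every $x\in\mathsf{X}$. Then the limits defining $\mathrm{var}(g,P)$ and, for all sufficiently large $N$, $\mathrm{var}(g,\tilde P_N)$ exist, $\mathrm{var}(g,P)<\infty$, and $$\lim_{N\to\infty}\mathrm{var}(g,\tilde P_N)=\mathrm{var}(g,P).$$ -/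

import Mathlib

open MeasureTheory ProbabilityTheory Filter Topology
open scoped NNReal ENNReal

namespace PseudoMarginal

noncomputable section

/-! ### Stationary Markov chains and asymptotic variance -/

section Chain

variable {E : Type*} [MeasurableSpace E]

/-- The law on `E^ℕ` of the Markov chain `(X_k)_{k ≥ 0}` with `X_0 ∼ μ` and transition kernel `K`
(the canonical, Ionescu-Tulcea, construction). -/
def chainLaw (μ : Measure E) (K : Kernel E E) [IsMarkovKernel K] : Measure (ℕ → E) :=
  Kernel.trajMeasure (X := fun _ => E) μ
    (fun n => K.comap (fun h : (i : Finset.Iic n) → E => h ⟨n, Finset.mem_Iic.2 le_rfl⟩)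
      (measurable_pi_apply _))

/-- `n⁻¹ 𝔼 (∑_{k=1}^n (f(X_k) - μ(f)))² ∈ [0, ∞]` for the chain with `X_0 ∼ μ`. -/
def scaledVar (f : E → ℝ) (μ : Measure E) (K : Kernel E E) [IsMarkovKernel K] (n : ℕ) : ℝ≥0∞ :=
  (∫⁻ ω, ENNReal.ofReal ((∑ k ∈ Finset.Icc 1 n, (f (ω k) - ∫ x, f x ∂μ)) ^ 2)
    ∂(chainLaw μ K)) / n

/-- The limit that defines the asymptotic variance exists in `[0, ∞]`. -/
def AsympVarExists (f : E → ℝ) (μ : Measure E) (K : Kernel E E) [IsMarkovKernel K] : Prop :=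
  ∃ v : ℝ≥0∞, Tendsto (scaledVar f μ K) atTop (𝓝 v)

/-- The asymptotic variance `var(f, K) = lim_n n⁻¹ 𝔼 (∑_{k=1}^n (f(X_k) - μ(f)))²`. -/
def asympVar (f : E → ℝ) (μ : Measure E) (K : Kernel E E) [IsMarkovKernel K] : ℝ≥0∞ :=
  limUnder atTop (scaledVar f μ K)

/-- `𝔼[f(X_0) f(X_k)]` for the chain with `X_0 ∼ μ`. -/
def lagProduct (f : E → ℝ) (μ : Measure E) (K : Kernel E E) [IsMarkovKernel K] (k : ℕ) : ℝ :=
  ∫ ω, f (ω 0) * f (ω k) ∂(chainLaw μ K)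

/-- The integrated autocorrelation time
`τ = 1 + 2 ∑_{k=1}^∞ (𝔼[f(X_0) f(X_k)] - μ(f)²) / var_μ(f)` is well defined and equal to the
real number `τ`; the series is understood as the limit of its partial sums. -/
def HasIACT (f : E → ℝ) (μ : Measure E) (K : Kernel E E) [IsMarkovKernel K] (τ : ℝ) : Prop :=
  Tendsto (fun n : ℕ => 1 + 2 * ∑ k ∈ Finset.Icc 1 n,
    (lagProduct f μ K k - (∫ x, f x ∂μ) ^ 2) / (∫ x, (f x - ∫ y, f y ∂μ) ^ 2 ∂μ)) atTop (𝓝 τ)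

end Chain

/-- The series `∑_{k=0}^∞ c k` converges (possibly only conditionally). -/
def SeriesConverges (c : ℕ → ℝ) : Prop :=
  ∃ s : ℝ, Tendsto (fun m : ℕ => ∑ k ∈ Finset.range m, c k) atTop (𝓝 s)

/-- The tail `∑_{k=n}^∞ c k`, as the limit of `∑_{k=n}^{m-1} c k`; meaningful for convergent
series. -/
def seriesTail (c : ℕ → ℝ) (n : ℕ) : ℝ :=
  limUnder atTop (fun m : ℕ => ∑ k ∈ Finset.Ico n m, c k)

/-! ### Metropolis-Hastings kernels -/

section MetropolisHastings

variable {E : Type*} [MeasurableSpace E]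

/-- The Metropolis-Hastings type kernel
`K(x, dy) = min{1, R(x,y)} q(x, dy) + ρ(x) δ_x(dy)` with `ρ(x) = 1 - ∫ min{1, R(x,y)} q(x, dy)`. -/
def mhKernel (q : Kernel E E) [IsMarkovKernel q] (R : E → E → ℝ≥0∞)
    (hR : Measurable (Function.uncurry R)) : Kernel E E where
  toFun x := (q x).withDensity (fun y => min 1 (R x y)) +
    (1 - ∫⁻ y, min 1 (R x y) ∂(q x)) • Measure.dirac x
  measurable' := by
    have hm : Measurable (fun p : E × E => min 1 (R p.1 p.2)) := measurable_const.min hR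
    refine Measure.measurable_of_measurable_coe _ fun s hs => ?_
    simp only [Measure.add_apply, Measure.smul_apply, smul_eq_mul, withDensity_apply _ hs]
    refine Measurable.add ?_ (Measurable.mul ?_ ?_)
    · exact hm.setLIntegral_kernel_prod_right hs
    · exact measurable_const.sub hm.lintegral_kernel_prod_right
    · exact (Measure.measurable_coe hs).comp Measure.measurable_dirac

instance mhKernel.instIsMarkovKernel (q : Kernel E E) [IsMarkovKernel q] (R : E → E → ℝ≥0∞)
    (hR : Measurable (Function.uncurry R)) : IsMarkovKernel (mhKernel q R hR) where
  isProbabilityMeasure x := ⟨by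
    have h : ∫⁻ y, min 1 (R x y) ∂(q x) ≤ 1 :=
      (lintegral_mono fun y => min_le_left _ _).trans (by simp)
    change ((q x).withDensity (fun y => min 1 (R x y)) +
      (1 - ∫⁻ y, min 1 (R x y) ∂(q x)) • Measure.dirac x) Set.univ = 1
    simp [add_tsub_cancel_of_le h]⟩

/-- `r` is a version of the Radon-Nikodym derivative
`r(x,y) = π(dy) q(y,dx) / (π(dx) q(x,dy))`, i.e. of the density, with respect to
`π(dx) q(x,dy)`, of the absolutely continuous part of its image under `(x,y) ↦ (y,x)`. -/
def IsMHRatio (π : Measure E) (q : Kernel E E) (r : E → E → ℝ≥0∞) : Prop :=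
  Function.uncurry r =ᵐ[π ⊗ₘ q] ((π ⊗ₘ q).map Prod.swap).rnDeriv (π ⊗ₘ q)

/-- The marginal algorithm: the Metropolis-Hastings kernel `P` with proposal `q` and ratio `r`. -/
abbrev marginalKernel (q : Kernel E E) [IsMarkovKernel q] (r : E → E → ℝ≥0∞)
    (hr : Measurable (Function.uncurry r)) : Kernel E E :=
  mhKernel q r hr

end MetropolisHastings

/-! ### The pseudo-marginal algorithm -/

section Pseudo

variable {X : Type*} [MeasurableSpace X] {W : Set ℝ≥0}

/-- The invariant law `π̃(dx, dw) = π(dx) Q_x(dw) w` on `X × W`. -/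
def pseudoTarget (π : Measure X) (Q : Kernel X W) [IsMarkovKernel Q] : Measure (X × W) :=
  π ⊗ₘ (Q.withDensity fun _ w => ((w : ℝ≥0) : ℝ≥0∞))

/-- The proposal `q̃(x, w; dy, du) = q(x, dy) Q_y(du)`. -/
def pseudoProposal (q : Kernel X X) (Q : Kernel X W) : Kernel (X × W) (X × W) :=
  Kernel.prodMkRight W (q ⊗ₖ Kernel.prodMkLeft X Q)

instance pseudoProposal.instIsMarkovKernel (q : Kernel X X) [IsMarkovKernel q]
    (Q : Kernel X W) [IsMarkovKernel Q] : IsMarkovKernel (pseudoProposal q Q) := by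
  unfold pseudoProposal
  infer_instance

/-- The acceptance ratio `r(x, y) u / w`. (Its value at `w = 0`, a null set of the invariant law,
is immaterial.) -/
def pseudoRatio (W : Set ℝ≥0) (r : X → X → ℝ≥0∞) (p p' : X × W) : ℝ≥0∞ :=
  r p.1 p'.1 * (((p'.2 : ℝ≥0) : ℝ≥0∞) / ((p.2 : ℝ≥0) : ℝ≥0∞))

lemma measurable_pseudoRatio {r : X → X → ℝ≥0∞} (hr : Measurable (Function.uncurry r)) :
    Measurable (Function.uncurry (pseudoRatio W r)) := by
  have h1 : Measurable (fun z : (X × W) × (X × W) => r z.1.1 z.2.1) :=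
    hr.comp ((measurable_fst.comp measurable_fst).prodMk (measurable_fst.comp measurable_snd))
  have h2 : Measurable (fun z : (X × W) × (X × W) => ((z.2.2 : ℝ≥0) : ℝ≥0∞)) := by fun_prop
  have h3 : Measurable (fun z : (X × W) × (X × W) => ((z.1.2 : ℝ≥0) : ℝ≥0∞)) := by fun_prop
  exact h1.mul (h2.div h3)

/-- The pseudo-marginal kernel
`P̃(x,w; dy,du) = min{1, r(x,y) u/w} q(x,dy) Q_y(du) + ρ̃(x,w) δ_{x,w}(dy,du)`. -/
abbrev pseudoKernel (q : Kernel X X) [IsMarkovKernel q] (r : X → X → ℝ≥0∞)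
    (hr : Measurable (Function.uncurry r)) (Q : Kernel X W) [IsMarkovKernel Q] :
    Kernel (X × W) (X × W) :=
  mhKernel (pseudoProposal q Q) (pseudoRatio W r) (measurable_pseudoRatio hr)

/-- Uniform convergence of the autocorrelation series: the integrated autocorrelation time
`τ(g, P)` is well defined and finite and there is `N₀` such that, with `ḡ = g - π(g)` and with
`(X̃_k^N)` the `X`-component of the chain started from `π̃_N` with kernel `P̃_N`, the series
`∑_k 𝔼[ḡ(X̃_0^N) ḡ(X̃_k^N)]` converges for all `N ≥ N₀` and
`lim_n sup_{N ≥ N₀} |∑_{k=n}^∞ 𝔼[ḡ(X̃_0^N) ḡ(X̃_k^N)]| = 0`. -/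
def UniformAutocorrTails (π : Measure X) (q : Kernel X X) [IsMarkovKernel q]
    (r : X → X → ℝ≥0∞) (hr : Measurable (Function.uncurry r))
    (Q : ℕ → Kernel X W) [∀ N, IsMarkovKernel (Q N)] (g : X → ℝ) : Prop :=
  let c : ℕ → ℕ → ℝ := fun N =>
    lagProduct (fun p : X × W => g p.1 - ∫ x, g x ∂π)
      (pseudoTarget π (Q N)) (pseudoKernel q r hr (Q N))
  (∃ τ : ℝ, HasIACT g π (marginalKernel q r hr) τ) ∧
  ∃ N₀ : ℕ, (∀ N ≥ N₀, SeriesConverges (c N)) ∧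
    Tendsto (fun n : ℕ => ⨆ N ≥ N₀, ENNReal.ofReal |seriesTail (c N) n|) atTop (𝓝 0)

end Pseudo

end

end PseudoMarginal

open PseudoMarginal

/-!
Asymptotic variances of pseudo-marginal chains converge to that of the marginal chain.

Both chains are stationary: the intensity of the accepted pseudo-marginal moves is
`π(dx) q(x, dy) Q_x(dw) Q_y(du) min {w, r(x, y) u}`, which is symmetric under `(x, w) ↔ (y, u)`
because `r(x, y) = f(y, x) / f(x, y)` for a density `f` of `π(dx) q(x, dy)` with respect to a
swap-invariant measure (`IsMHRatio.lintegral_min_swap`). For a stationary chain with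
autocovariances `c_k`, the increments of `n ↦ 𝔼 (∑_{k=1}^n [f(X_k) - μ(f)])²` are the partial sums of
`c_0 + 2 ∑_{k ≥ 1} c_k`, so by Cesàro summation the asymptotic variance exists and equals
`c_0 + 2 ∑_{k ≥ 1} c_k` as soon as this series converges (`tendsto_scaledVar`). Convergence of the
series is among the hypotheses for the pseudo-marginal chains, and for the marginal chain it follows
from the finiteness of the integrated autocorrelation time. No spectral theory is involved.

As the tails of the series are uniformly small, it remains to prove that each `c_k^N` tends to `c_k`
(`tendsto_lagProduct`). For bounded functions this is an induction on `k` which replaces one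
pseudo-marginal transition by a marginal one at a time. By stationarity, each replacement costs at
most a constant times the mean difference of the acceptance probabilities,
`∫ π(dx) q(x, dy) Q_x(dw) Q_y(du) |min {w, r u} - min {w, r w}|`. The integral over the weights is
at most `r(x, y)` times the sum of the `L¹` distances of the weights to `1` at `x` and `y`, and also
bounded because the weights have mean `1`, so dominated convergence applies
(`tendsto_lintegral_gap_ratio`). Square integrable functions are reached by truncation, with an
error uniform in `N` since the first coordinate has law `π` for every `N`.
-/

namespace PseudoMarginal

/-! ### Stationarity and the Markov property of the canonical chain -/

section Chain

variable {E : Type*} [MeasurableSpace E] {μ : Measure E} {K : Kernel E E} [IsMarkovKernel K]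

lemma chainLaw_map_eval_zero : (chainLaw μ K).map (fun ω => ω 0) = μ := by
  have h : (fun ω : ℕ → E => ω 0) =
      (fun h : (i : Finset.Iic 0) → E => h ⟨0, Finset.mem_Iic.2 le_rfl⟩) ∘
        Preorder.frestrictLe (π := fun _ => E) 0 := rfl
  rw [h, ← Measure.map_map (by fun_prop) (by fun_prop), chainLaw, Kernel.trajMeasure,
    Measure.map_comp _ _ (by fun_prop), Kernel.traj_map_frestrictLe, Kernel.partialTraj_self,
    Measure.id_comp, Measure.map_map (by fun_prop) (by fun_prop)]
  exact Measure.map_id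

variable [IsProbabilityMeasure μ]

instance chainLaw.instIsProbabilityMeasure : IsProbabilityMeasure (chainLaw μ K) := by
  unfold chainLaw
  infer_instance

/-- The Markov property of the canonical chain, for the whole history up to time `n`. -/
lemma chainLaw_map_history_succ (n : ℕ) :
    (chainLaw μ K).map (fun ω => (Preorder.frestrictLe n ω, ω (n + 1))) =
      ((chainLaw μ K).map (Preorder.frestrictLe (π := fun _ => E) n)) ⊗ₘ
        K.comap (fun h : (i : Finset.Iic n) → E => h ⟨n, Finset.mem_Iic.2 le_rfl⟩)
          (measurable_pi_apply _) :=
  (Kernel.map_frestrictLe_trajMeasure_compProd_eq_map_trajMeasure (X := fun _ => E)).symm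

/-- The Markov property for a pair of times: the next state is drawn from `K`. -/
lemma chainLaw_map_pair_succ {j n : ℕ} (hj : j ≤ n) :
    (chainLaw μ K).map (fun ω => (ω j, ω (n + 1))) =
      (Kernel.id ∥ₖ K) ∘ₘ ((chainLaw μ K).map (fun ω => (ω j, ω n))) := by
  have h : (fun ω : ℕ → E => (ω j, ω (n + 1))) =
      (fun z : ((i : Finset.Iic n) → E) × E => (z.1 ⟨j, Finset.mem_Iic.2 hj⟩, z.2)) ∘
        (fun ω => (Preorder.frestrictLe (π := fun _ => E) n ω, ω (n + 1))) := rfl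
  rw [h, ← Measure.map_map (by fun_prop) (by fun_prop), chainLaw_map_history_succ]
  ext s hs
  rw [Measure.map_apply (by fun_prop) hs, Measure.compProd_apply (hs.preimage (by fun_prop)),
    Measure.bind_apply hs (Kernel.aemeasurable _), lintegral_map (Kernel.measurable_coe _ hs)
      (by fun_prop), lintegral_map (Kernel.measurable_kernel_prodMk_left
        (hs.preimage (by fun_prop))) (by fun_prop)]
  refine lintegral_congr fun ω => ?_
  rw [Kernel.parallelComp_apply, Kernel.id_apply, Measure.prod_apply hs, lintegral_dirac'
    _ (measurable_measure_prodMk_left hs)]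
  rfl

/-- A chain started from its invariant law is stationary; here, its one-dimensional marginals. -/
lemma measurePreserving_eval (hK : K.Invariant μ) (k : ℕ) :
    MeasurePreserving (fun ω : ℕ → E => ω k) (chainLaw μ K) μ := by
  refine ⟨measurable_pi_apply _, ?_⟩
  induction k with
  | zero => exact chainLaw_map_eval_zero
  | succ k ih =>
    have h1 := congrArg (Measure.map Prod.snd) (chainLaw_map_pair_succ (μ := μ) (K := K) (le_refl k))
    rw [Measure.map_map (by fun_prop) (by fun_prop)] at h1
    refine h1.trans ?_
    ext s hs
    rw [Measure.map_apply measurable_snd hs, Measure.bind_apply (measurable_snd hs)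
      (Kernel.aemeasurable _), lintegral_map (Kernel.measurable_coe _ (measurable_snd hs))
      (by fun_prop)]
    conv_rhs => rw [← hK.def, Measure.bind_apply hs (Kernel.aemeasurable _), ← ih,
      lintegral_map (Kernel.measurable_coe _ hs) (by fun_prop)]
    refine lintegral_congr fun ω => ?_
    rw [Kernel.parallelComp_apply, Kernel.id_apply, ← Set.univ_prod, Measure.prod_prod]
    simp

/-- Stationarity of the two-dimensional marginals. -/
lemma chainLaw_map_pair_shift (hK : K.Invariant μ) (j k : ℕ) :
    (chainLaw μ K).map (fun ω => (ω j, ω (j + k))) =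
      (chainLaw μ K).map (fun ω => (ω 0, ω k)) := by
  induction k with
  | zero =>
    have h (i : ℕ) : (chainLaw μ K).map (fun ω => (ω i, ω i)) = μ.map (fun x => (x, x)) := by
      conv_rhs => rw [← (measurePreserving_eval hK i).map_eq,
        Measure.map_map (by fun_prop) (by fun_prop)]
      rfl
    exact (h j).trans (h 0).symm
  | succ k ih =>
    rw [← add_assoc, chainLaw_map_pair_succ (Nat.le_add_right j k), ih,
      chainLaw_map_pair_succ (Nat.zero_le k)]

/-- The Markov property for a bounded function of the state at time `k + 1`. -/
lemma integral_mul_eval_succ {h f : E → ℝ} (hh : Measurable h) (hf : Measurable f) {A B : ℝ}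
    (hA : ∀ x, |h x| ≤ A) (hB : ∀ x, |f x| ≤ B) (k : ℕ) :
    ∫ ω, h (ω 0) * f (ω (k + 1)) ∂(chainLaw μ K) =
      ∫ ω, h (ω 0) * ∫ y, f y ∂(K (ω k)) ∂(chainLaw μ K) := by
  let G : ((i : Finset.Iic k) → E) × E → ℝ :=
    fun z => h (z.1 ⟨0, Finset.mem_Iic.2 (Nat.zero_le k)⟩) * f z.2
  have hG : Measurable G := by fun_prop
  have hr : Measurable (Preorder.frestrictLe (π := fun _ => E) k) := by fun_prop
  have hr' : Measurable (fun ω : ℕ → E =>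
      (Preorder.frestrictLe (π := fun _ => E) k ω, ω (k + 1))) := by fun_prop
  have e1 : ∫ ω, h (ω 0) * f (ω (k + 1)) ∂(chainLaw μ K) =
      ∫ z, G z ∂((chainLaw μ K).map
        (fun ω => (Preorder.frestrictLe (π := fun _ => E) k ω, ω (k + 1)))) :=
    (integral_map hr'.aemeasurable hG.aestronglyMeasurable).symm
  rw [e1, chainLaw_map_history_succ]
  have hprob : IsProbabilityMeasure
      ((chainLaw μ K).map (Preorder.frestrictLe (π := fun _ => E) k)) :=
    Measure.isProbabilityMeasure_map (by fun_prop)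
  rw [Measure.integral_compProd, integral_map hr.aemeasurable]
  · refine integral_congr_ae (ae_of_all _ fun ω => ?_)
    exact integral_const_mul (h (ω 0)) f
  · exact (hG.stronglyMeasurable.integral_kernel_prod_right').aestronglyMeasurable
  · refine Integrable.of_bound hG.aestronglyMeasurable (A * B) (ae_of_all _ fun z => ?_)
    rw [Real.norm_eq_abs, abs_mul]
    have hA0 := hA (z.1 ⟨0, Finset.mem_Iic.2 (Nat.zero_le k)⟩)
    exact mul_le_mul hA0 (hB _) (abs_nonneg _) ((abs_nonneg _).trans hA0)

end Chain

/-! ### Invariant laws of the marginal and pseudo-marginal kernels -/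

section MetropolisHastings

variable {E : Type*} [MeasurableSpace E]

/-- Detailed balance for the accepted moves is detailed balance for the kernel, as the rejected
moves stay on the diagonal. -/
lemma invariant_mhKernel {μ : Measure E} {q : Kernel E E} [IsMarkovKernel q] {R : E → E → ℝ≥0∞}
    (hR : Measurable (Function.uncurry R))
    (hsym : ∀ A B, MeasurableSet A → MeasurableSet B →
      ∫⁻ x, ∫⁻ y, A.indicator 1 x * B.indicator 1 y * min 1 (R x y) ∂(q x) ∂μ =
      ∫⁻ x, ∫⁻ y, B.indicator 1 x * A.indicator 1 y * min 1 (R x y) ∂(q x) ∂μ) :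
    (mhKernel q R hR).Invariant μ := by
  refine Kernel.IsReversible.invariant ?_
  have hm : Measurable (fun p : E × E => min 1 (R p.1 p.2)) := measurable_const.min hR
  have key : ∀ A B, MeasurableSet A → MeasurableSet B →
      ∫⁻ x in A, mhKernel q R hR x B ∂μ =
        ∫⁻ x, ∫⁻ y, A.indicator 1 x * B.indicator 1 y * min 1 (R x y) ∂(q x) ∂μ +
          ∫⁻ x in A ∩ B, (1 - ∫⁻ y, min 1 (R x y) ∂(q x)) ∂μ := by
    intro A B hA hB
    have h1 : Measurable fun x => 1 - ∫⁻ y, min 1 (R x y) ∂(q x) :=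
      measurable_const.sub hm.lintegral_kernel_prod_right
    rw [← lintegral_indicator hA, ← lintegral_indicator (hA.inter hB),
      ← lintegral_add_right _ (h1.indicator (hA.inter hB))]
    refine lintegral_congr fun x => ?_
    have hx : mhKernel q R hR x B = ∫⁻ y in B, min 1 (R x y) ∂(q x) +
        (1 - ∫⁻ y, min 1 (R x y) ∂(q x)) * B.indicator 1 x := by
      change ((q x).withDensity (fun y => min 1 (R x y)) +
        (1 - ∫⁻ y, min 1 (R x y) ∂(q x)) • Measure.dirac x) B = _
      rw [Measure.add_apply, withDensity_apply _ hB, Measure.smul_apply,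
        Measure.dirac_apply' _ hB, smul_eq_mul]
    by_cases hxA : x ∈ A
    · rw [Set.indicator_of_mem hxA, hx, ← lintegral_indicator hB]
      congr 1
      · refine lintegral_congr fun y => ?_
        by_cases hy : y ∈ B <;> simp [hxA, hy]
      · by_cases hxB : x ∈ B <;> simp [hxA, hxB]
    · simp [hxA]
  intro A B hA hB
  rw [key A B hA hB, key B A hB hA, hsym A B hA hB, Set.inter_comm]

/-- The mean of a bounded function after one Metropolis-Hastings step, written with the increments
`f y - f x` so that the rejected moves do not contribute. -/
lemma integral_mhKernel {q : Kernel E E} [IsMarkovKernel q] {R : E → E → ℝ≥0∞}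
    (hR : Measurable (Function.uncurry R)) {f : E → ℝ} (hf : Measurable f) {B : ℝ}
    (hB : ∀ x, |f x| ≤ B) (x : E) :
    ∫ y, f y ∂(mhKernel q R hR x) = f x + ∫ y, (min 1 (R x y)).toReal * (f y - f x) ∂(q x) := by
  have hm : Measurable (fun y => min 1 (R x y)) :=
    measurable_const.min (hR.comp measurable_prodMk_left)
  have hle : ∀ y, min 1 (R x y) ≤ 1 := fun y => min_le_left _ _
  have hlt : ∀ y, min 1 (R x y) < ∞ := fun y => (hle y).trans_lt ENNReal.one_lt_top
  have hle' : ∀ y, (min 1 (R x y)).toReal ≤ 1 := fun y => by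
    simpa using ENNReal.toReal_mono ENNReal.one_ne_top (hle y)
  have hi : ∫⁻ y, min 1 (R x y) ∂(q x) ≤ 1 := (lintegral_mono hle).trans (by simp)
  have hfin : IsFiniteMeasure ((q x).withDensity fun y => min 1 (R x y)) :=
    isFiniteMeasure_withDensity (hi.trans_lt ENNReal.one_lt_top).ne
  have hfi (ν : Measure E) [IsFiniteMeasure ν] : Integrable f ν :=
    Integrable.of_bound hf.aestronglyMeasurable B (ae_of_all _ hB)
  have hmi : Integrable (fun y => (min 1 (R x y)).toReal) (q x) :=
    Integrable.of_bound hm.ennreal_toReal.aestronglyMeasurable 1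
      (ae_of_all _ fun y => by simpa using hle' y)
  have hmfi : Integrable (fun y => (min 1 (R x y)).toReal * f y) (q x) :=
    (hfi (q x)).bdd_mul (c := 1) hm.ennreal_toReal.aestronglyMeasurable
      (ae_of_all _ fun y => by simpa using hle' y)
  change ∫ y, f y ∂((q x).withDensity (fun y => min 1 (R x y)) +
    (1 - ∫⁻ y, min 1 (R x y) ∂(q x)) • Measure.dirac x) = _
  have hc : (1 - ∫⁻ y, min 1 (R x y) ∂(q x)) ≠ ∞ := ENNReal.sub_ne_top ENNReal.one_ne_top
  rw [integral_add_measure (hfi _) ((hfi _).smul_measure hc), integral_smul_measure,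
    integral_dirac' _ _ hf.stronglyMeasurable,
    integral_withDensity_eq_integral_toReal_smul hm (ae_of_all _ hlt),
    ENNReal.toReal_sub_of_le hi ENNReal.one_ne_top, ← integral_toReal hm.aemeasurable
      (ae_of_all _ hlt)]
  simp only [mul_sub, smul_eq_mul]
  rw [integral_sub hmfi (hmi.mul_const _), integral_mul_const, ENNReal.toReal_one]
  ring

/-- With respect to a swap-invariant reference measure `ν`, the proposal measure `π(dx) q(x, dy)`
has a density `f` and the ratio is `f(y, x) / f(x, y)`: this is what makes the accepted moves
symmetric. The formulation covers the points with `f(x, y) = 0`, where `r` is arbitrary. -/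
lemma IsMHRatio.exists_density {π : Measure E} [IsProbabilityMeasure π] {q : Kernel E E}
    [IsMarkovKernel q] {r : E → E → ℝ≥0∞} (hrπ : IsMHRatio π q r) :
    ∃ (ν : Measure (E × E)) (f : E × E → ℝ≥0∞), IsFiniteMeasure ν ∧ Measurable f ∧
      MeasurePreserving Prod.swap ν ν ∧ π ⊗ₘ q = ν.withDensity f ∧
      ∀ᵐ z ∂ν, ∀ a b, f z * min a (r z.1 z.2 * b) = min (f z * a) (f z.swap * b) := by
  set m := π ⊗ₘ q with hm
  set m' := m.map Prod.swap with hm'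
  have hswap : m'.map Prod.swap = m := by
    rw [hm', Measure.map_map measurable_swap measurable_swap]
    simp
  have : IsProbabilityMeasure m' := Measure.isProbabilityMeasure_map (by fun_prop)
  have hν : (m' + m).map Prod.swap = m' + m := by
    rw [Measure.map_add _ _ measurable_swap, hswap, add_comm]
  have hac : m ≪ m' + m := Measure.AbsolutelyContinuous.rfl.add_right' _
  have hd : m = (m' + m).withDensity (m.rnDeriv (m' + m)) :=
    (Measure.withDensity_rnDeriv_eq _ _ hac).symm
  have hf : Measurable (m.rnDeriv (m' + m)) := Measure.measurable_rnDeriv _ _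
  refine ⟨m' + m, m.rnDeriv (m' + m), inferInstance, hf,
    ⟨measurable_swap, hν⟩, hd, ?_⟩
  -- the density of the swapped measure is the swapped density
  have h1 := (MeasurableEquiv.prodComm (α := E) (β := E)).measurableEmbedding.rnDeriv_map m'
    (m' + m)
  have h1' : (fun z : E × E => m.rnDeriv (m' + m) z.swap) =ᵐ[m' + m] m'.rnDeriv (m' + m) := by
    have e : (⇑(MeasurableEquiv.prodComm (α := E) (β := E))) = Prod.swap := rfl
    rwa [e, hν, hswap] at h1
  have h2 : ∀ᵐ z ∂m, r z.1 z.2 = m'.rnDeriv (m' + m) z / m.rnDeriv (m' + m) z := by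
    have h3 : Function.uncurry r =ᵐ[m] m'.rnDeriv m := hrπ
    filter_upwards [h3, m'.rnDeriv_eq_div_rnDeriv_add m] with z hz hz'
    rw [← hz', ← hz]
    rfl
  rw [hd, ae_withDensity_iff hf, ← hd] at h2
  filter_upwards [h1', h2, m.rnDeriv_ne_top (m' + m)] with z hz1 hz2 hz3 a b
  by_cases h0 : m.rnDeriv (m' + m) z = 0
  · simp [h0]
  · rw [hz2 h0, hz1, (mul_right_mono (a := m.rnDeriv (m' + m) z)).map_min, ← mul_assoc,
      ENNReal.mul_div_cancel h0 hz3]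

end MetropolisHastings

section Pseudo

variable {X : Type*} [MeasurableSpace X] {W : Set ℝ≥0}

lemma measurable_uncurry_weight :
    Measurable (Function.uncurry fun (_ : X) (w : W) => ((w : ℝ≥0) : ℝ≥0∞)) := by
  change Measurable fun p : X × W => ((p.2 : ℝ≥0) : ℝ≥0∞)
  fun_prop

/-- The accepted moves of the pseudo-marginal chain are symmetric: their intensity is
`π(dx) q(x, dy) Q_x(dw) Q_y(du) min {w, r(x, y) u}`, invariant under `(x, w) ↔ (y, u)`. -/
lemma IsMHRatio.lintegral_min_swap {π : Measure X} [IsProbabilityMeasure π] {q : Kernel X X}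
    [IsMarkovKernel q] {r : X → X → ℝ≥0∞} (hr : Measurable (Function.uncurry r))
    (hrπ : IsMHRatio π q r) (Q : Kernel X W) [IsMarkovKernel Q]
    {H : (X × X) × (W × W) → ℝ≥0∞} (hH : Measurable H) :
    ∫⁻ z, ∫⁻ s, H (z, s) * min ((s.1 : ℝ≥0) : ℝ≥0∞) (r z.1 z.2 * ((s.2 : ℝ≥0) : ℝ≥0∞))
        ∂((Q ∥ₖ Q) z) ∂(π ⊗ₘ q) =
      ∫⁻ z, ∫⁻ s, H (z.swap, s.swap) *
        min ((s.1 : ℝ≥0) : ℝ≥0∞) (r z.1 z.2 * ((s.2 : ℝ≥0) : ℝ≥0∞)) ∂((Q ∥ₖ Q) z) ∂(π ⊗ₘ q) := by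
  obtain ⟨ν, f, hν, hf, hsw, hd, hfr⟩ := hrπ.exists_density
  have hr2 : Measurable fun p : (X × X) × (W × W) => r p.1.1 p.1.2 :=
    hr.comp measurable_fst
  have key : ∀ G : (X × X) × (W × W) → ℝ≥0∞, Measurable G →
      ∫⁻ z, ∫⁻ s, G (z, s) * min ((s.1 : ℝ≥0) : ℝ≥0∞) (r z.1 z.2 * ((s.2 : ℝ≥0) : ℝ≥0∞))
          ∂((Q ∥ₖ Q) z) ∂(π ⊗ₘ q) =
        ∫⁻ z, ∫⁻ s, G (z, s) * min (f z * ((s.1 : ℝ≥0) : ℝ≥0∞))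
          (f z.swap * ((s.2 : ℝ≥0) : ℝ≥0∞)) ∂((Q ∥ₖ Q) z) ∂ν := by
    intro G hG
    have hM : Measurable fun p : (X × X) × (W × W) =>
        G p * min ((p.2.1 : ℝ≥0) : ℝ≥0∞) (r p.1.1 p.1.2 * ((p.2.2 : ℝ≥0) : ℝ≥0∞)) := by
      fun_prop
    rw [hd, lintegral_withDensity_eq_lintegral_mul _ hf (hM.lintegral_kernel_prod_right')]
    refine lintegral_congr_ae ?_
    filter_upwards [hfr] with z hz
    have hMz : Measurable fun s : W × W => G (z, s) *
        min ((s.1 : ℝ≥0) : ℝ≥0∞) (r z.1 z.2 * ((s.2 : ℝ≥0) : ℝ≥0∞)) :=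
      hM.comp (measurable_prodMk_left (x := z))
    rw [Pi.mul_apply, ← lintegral_const_mul _ hMz]
    refine lintegral_congr fun s => ?_
    rw [← hz]
    ring
  have hN : Measurable fun z : X × X => ∫⁻ s, H (z, s) * min (f z * ((s.1 : ℝ≥0) : ℝ≥0∞))
      (f z.swap * ((s.2 : ℝ≥0) : ℝ≥0∞)) ∂((Q ∥ₖ Q) z) := by
    refine Measurable.lintegral_kernel_prod_right' (f := fun p : (X × X) × (W × W) =>
      H p * min (f p.1 * ((p.2.1 : ℝ≥0) : ℝ≥0∞)) (f p.1.swap * ((p.2.2 : ℝ≥0) : ℝ≥0∞))) ?_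
    fun_prop
  -- after `key`, swapping the points under `ν` and the weights exchanges the two sides
  rw [key H hH, key (fun p => H (p.1.swap, p.2.swap)) (by fun_prop), ← hsw.lintegral_comp hN]
  refine lintegral_congr fun z => ?_
  rw [Kernel.parallelComp_apply, Kernel.parallelComp_apply, Prod.fst_swap, Prod.snd_swap,
    ← Measure.prod_swap, lintegral_map (by fun_prop) measurable_swap]
  refine lintegral_congr fun s => ?_
  rw [min_comm]
  simp

/-- The marginal algorithm leaves `π` invariant. -/
lemma invariant_marginalKernel {π : Measure X} [IsProbabilityMeasure π] {q : Kernel X X}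
    [IsMarkovKernel q] {r : X → X → ℝ≥0∞} (hr : Measurable (Function.uncurry r))
    (hrπ : IsMHRatio π q r) : (marginalKernel q r hr).Invariant π := by
  refine invariant_mhKernel hr fun A B hA hB => ?_
  -- the marginal algorithm is the pseudo-marginal one with weights identically `1`
  have h (A B : Set X) (hA : MeasurableSet A) (hB : MeasurableSet B) :
      ∫⁻ x, ∫⁻ y, A.indicator 1 x * B.indicator 1 y * min 1 (r x y) ∂(q x) ∂π =
      ∫⁻ z, A.indicator 1 z.1 * B.indicator 1 z.2 * min 1 (r z.1 z.2) ∂(π ⊗ₘ q) := by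
    rw [Measure.lintegral_compProd]
    exact ((measurable_one.indicator hA).comp measurable_fst |>.mul
      ((measurable_one.indicator hB).comp measurable_snd)).mul (measurable_const.min hr)
  let w₁ : (Set.univ : Set ℝ≥0) := ⟨1, trivial⟩
  have h2 := hrπ.lintegral_min_swap hr (Kernel.const X (Measure.dirac w₁))
    (H := fun p => A.indicator 1 p.1.1 * B.indicator 1 p.1.2)
    (((measurable_one.indicator hA).comp (measurable_fst.comp measurable_fst)).mul
      ((measurable_one.indicator hB).comp (measurable_snd.comp measurable_fst)))
  rw [h A B hA hB, h B A hB hA]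
  simp only [Kernel.parallelComp_apply, Kernel.const_apply, Measure.dirac_prod_dirac,
    lintegral_dirac] at h2
  simpa [w₁, mul_comm (B.indicator 1 _ : ℝ≥0∞)] using h2

lemma isMarkovKernel_withDensity_weight {Q : Kernel X W} [IsMarkovKernel Q]
    (hQ : ∀ x, ∫⁻ w, ((w : ℝ≥0) : ℝ≥0∞) ∂(Q x) = 1) :
    IsMarkovKernel (Q.withDensity fun _ w => ((w : ℝ≥0) : ℝ≥0∞)) where
  isProbabilityMeasure x := ⟨by
    rw [Kernel.withDensity_apply' _ measurable_uncurry_weight]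
    simpa using hQ x⟩

lemma isProbabilityMeasure_pseudoTarget (π : Measure X) [IsProbabilityMeasure π]
    {Q : Kernel X W} [IsMarkovKernel Q] (hQ : ∀ x, ∫⁻ w, ((w : ℝ≥0) : ℝ≥0∞) ∂(Q x) = 1) :
    IsProbabilityMeasure (pseudoTarget π Q) := by
  have := isMarkovKernel_withDensity_weight hQ
  unfold pseudoTarget
  infer_instance

lemma measurePreserving_fst_pseudoTarget (π : Measure X) [IsProbabilityMeasure π]
    {Q : Kernel X W} [IsMarkovKernel Q] (hQ : ∀ x, ∫⁻ w, ((w : ℝ≥0) : ℝ≥0∞) ∂(Q x) = 1) :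
    MeasurePreserving Prod.fst (pseudoTarget π Q) π := by
  have := isMarkovKernel_withDensity_weight hQ
  exact ⟨measurable_fst, Measure.fst_compProd π _⟩

lemma measurePreserving_fst_pseudoProposal (q : Kernel X X) [IsMarkovKernel q] (Q : Kernel X W)
    [IsMarkovKernel Q] (p : X × W) :
    MeasurePreserving Prod.fst (pseudoProposal q Q p) (q p.1) := by
  refine ⟨measurable_fst, ?_⟩
  rw [pseudoProposal, Kernel.prodMkRight_apply, ← Kernel.map_apply _ measurable_fst,
    ← Kernel.fst_eq, Kernel.fst_compProd]

/-- A proposed move of the stationary pseudo-marginal chain, with the weights integrated inside. -/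
lemma lintegral_pseudoTarget_pseudoProposal (π : Measure X) [IsProbabilityMeasure π]
    (q : Kernel X X) [IsMarkovKernel q] (Q : Kernel X W) [IsMarkovKernel Q]
    {F : (X × W) × (X × W) → ℝ≥0∞} (hF : Measurable F) :
    ∫⁻ p, ∫⁻ p', F (p, p') ∂(pseudoProposal q Q p) ∂(pseudoTarget π Q) =
      ∫⁻ z, ∫⁻ s, ((s.1 : ℝ≥0) : ℝ≥0∞) * F ((z.1, s.1), (z.2, s.2)) ∂((Q ∥ₖ Q) z)
        ∂(π ⊗ₘ q) := by
  have hM : Measurable fun p : (X × X) × (W × W) =>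
      ((p.2.1 : ℝ≥0) : ℝ≥0∞) * F ((p.1.1, p.2.1), (p.1.2, p.2.2)) := by fun_prop
  have hF1 : Measurable fun p : X × W => ∫⁻ p', F (p, p') ∂(pseudoProposal q Q p) :=
    hF.lintegral_kernel_prod_right'
  rw [pseudoTarget, Measure.lintegral_compProd hF1, Measure.lintegral_compProd
    hM.lintegral_kernel_prod_right']
  refine lintegral_congr fun x => ?_
  have hprop : ∀ w : W, ∫⁻ p', F ((x, w), p') ∂(pseudoProposal q Q (x, w)) =
      ∫⁻ y, ∫⁻ u, F ((x, w), (y, u)) ∂(Q y) ∂(q x) := by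
    intro w
    rw [pseudoProposal, Kernel.prodMkRight_apply, Kernel.lintegral_compProd _ _ _ (by fun_prop)]
    rfl
  have hFx : Measurable fun w : W => ∫⁻ p', F ((x, w), p') ∂(pseudoProposal q Q (x, w)) :=
    hF1.comp (measurable_prodMk_left (x := x))
  rw [Kernel.lintegral_withDensity _ measurable_uncurry_weight _ hFx]
  simp_rw [hprop]
  have hM2 : Measurable fun p : (W × X) × W => F ((x, p.1.1), (p.1.2, p.2)) := by fun_prop
  have hM3 : Measurable fun p : W × X => ∫⁻ u, F ((x, p.1), (p.2, u)) ∂(Q p.2) :=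
    Measurable.lintegral_kernel_prod_right' (κ := Q.comap Prod.snd measurable_snd) hM2
  -- the weight is moved inside the integral over `y`, after which Tonelli's theorem applies
  have hconst : ∀ w : W, ((w : ℝ≥0) : ℝ≥0∞) * ∫⁻ y, ∫⁻ u, F ((x, w), (y, u)) ∂(Q y) ∂(q x) =
      ∫⁻ y, ((w : ℝ≥0) : ℝ≥0∞) * ∫⁻ u, F ((x, w), (y, u)) ∂(Q y) ∂(q x) := fun w =>
    (lintegral_const_mul _ (hM3.comp (measurable_prodMk_left (x := w)))).symm
  simp_rw [hconst]
  rw [lintegral_lintegral_swap (by fun_prop)]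
  refine lintegral_congr fun y => ?_
  rw [Kernel.parallelComp_apply, lintegral_prod _ (by fun_prop)]
  refine lintegral_congr fun w => ?_
  exact (lintegral_const_mul ((w : ℝ≥0) : ℝ≥0∞)
    (f := fun u : W => F ((x, w), (y, u))) (by fun_prop)).symm

/-- The value at `w = 0` of the acceptance ratio plays no role, being multiplied by the weight. -/
lemma weight_mul_min_ratio (r : ℝ≥0∞) (w u : ℝ≥0) :
    (w : ℝ≥0∞) * min 1 (r * ((u : ℝ≥0∞) / w)) = min (w : ℝ≥0∞) (r * u) := by
  by_cases hw : w = 0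
  · simp [hw]
  · rw [(mul_right_mono (a := (w : ℝ≥0∞))).map_min, mul_one, mul_left_comm,
      ENNReal.mul_div_cancel (by simpa using hw) ENNReal.coe_ne_top]

/-- The pseudo-marginal algorithm leaves its target invariant. -/
lemma invariant_pseudoKernel {π : Measure X} [IsProbabilityMeasure π] {q : Kernel X X}
    [IsMarkovKernel q] {r : X → X → ℝ≥0∞} (hr : Measurable (Function.uncurry r))
    (hrπ : IsMHRatio π q r) (Q : Kernel X W) [IsMarkovKernel Q] :
    (pseudoKernel q r hr Q).Invariant (pseudoTarget π Q) := by
  refine invariant_mhKernel _ fun A B hA hB => ?_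
  have hmeas (A B : Set (X × W)) (hA : MeasurableSet A) (hB : MeasurableSet B) :
      Measurable fun p : (X × W) × (X × W) => (A.indicator 1 p.1 * B.indicator 1 p.2 : ℝ≥0∞) :=
    ((measurable_one.indicator hA).comp measurable_fst).mul
      ((measurable_one.indicator hB).comp measurable_snd)
  have h (A B : Set (X × W)) (hA : MeasurableSet A) (hB : MeasurableSet B) :
      ∫⁻ p, ∫⁻ p', A.indicator 1 p * B.indicator 1 p' * min 1 (pseudoRatio W r p p')
        ∂(pseudoProposal q Q p) ∂(pseudoTarget π Q) =
      ∫⁻ z, ∫⁻ s, (A.indicator 1 (z.1, s.1) * B.indicator 1 (z.2, s.2)) *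
        min ((s.1 : ℝ≥0) : ℝ≥0∞) (r z.1 z.2 * ((s.2 : ℝ≥0) : ℝ≥0∞)) ∂((Q ∥ₖ Q) z)
        ∂(π ⊗ₘ q) := by
    refine (lintegral_pseudoTarget_pseudoProposal π q Q
      ((hmeas A B hA hB).mul (measurable_const.min (measurable_pseudoRatio hr)))).trans ?_
    refine lintegral_congr fun z => lintegral_congr fun s => ?_
    rw [← weight_mul_min_ratio]
    exact mul_left_comm _ _ _
  rw [h A B hA hB, h B A hB hA]
  have h2 := hrπ.lintegral_min_swap hr Q
    (H := fun p => A.indicator 1 (p.1.1, p.2.1) * B.indicator 1 (p.1.2, p.2.2))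
    ((hmeas A B hA hB).comp (f := fun p : (X × X) × (W × W) => ((p.1.1, p.2.1), (p.1.2, p.2.2)))
      (by fun_prop))
  refine h2.trans (lintegral_congr fun z => lintegral_congr fun s => ?_)
  congr 1
  exact mul_comm _ _

end Pseudo

/-! ### Convergence of the lagged products of bounded functions -/

/-- The distance `|a - b|` on `[0, ∞]`, as the sum of the two truncated differences. -/
noncomputable def gap (a b : ℝ≥0∞) : ℝ≥0∞ := (a - b) + (b - a)

lemma gap_triangle (a b c : ℝ≥0∞) : gap a c ≤ gap b a + gap b c := by
  have h : ∀ x y z : ℝ≥0∞, x - z ≤ (x - y) + (y - z) := fun x y z =>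
    tsub_le_tsub_add_tsub
  unfold gap
  calc (a - c) + (c - a) ≤ ((a - b) + (b - c)) + ((c - b) + (b - a)) :=
        add_le_add (h _ _ _) (h _ _ _)
    _ = _ := by ring

lemma measurable_gap {α : Type*} [MeasurableSpace α] {f g : α → ℝ≥0∞} (hf : Measurable f)
    (hg : Measurable g) : Measurable fun x => gap (f x) (g x) :=
  (hf.sub hg).add (hg.sub hf)

lemma enorm_toReal_sub_toReal_le_gap {a b : ℝ≥0∞} (ha : a ≠ ∞) (hb : b ≠ ∞) :
    ‖a.toReal - b.toReal‖ₑ ≤ gap a b := by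
  rw [Real.enorm_eq_ofReal_abs]
  rcases le_total a b with h | h
  · rw [abs_sub_comm, ← ENNReal.toReal_sub_of_le h hb, abs_of_nonneg ENNReal.toReal_nonneg,
      ENNReal.ofReal_toReal (ENNReal.sub_ne_top hb)]
    exact le_add_self
  · rw [← ENNReal.toReal_sub_of_le h ha, abs_of_nonneg ENNReal.toReal_nonneg,
      ENNReal.ofReal_toReal (ENNReal.sub_ne_top ha)]
    exact le_self_add

lemma gap_one_coe (w : ℝ≥0) : gap 1 (w : ℝ≥0∞) = ENNReal.ofReal |1 - (w : ℝ)| := by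
  unfold gap
  rcases le_total w 1 with h | h
  · have h' : (w : ℝ) ≤ 1 := h
    rw [abs_of_nonneg (sub_nonneg.2 h'), tsub_eq_zero_of_le (show (w : ℝ≥0∞) ≤ 1 by exact_mod_cast h),
      add_zero, ENNReal.ofReal_sub _ w.coe_nonneg]
    simp
  · have h' : (1 : ℝ) ≤ w := h
    rw [abs_sub_comm, abs_of_nonneg (sub_nonneg.2 h'),
      tsub_eq_zero_of_le (show (1 : ℝ≥0∞) ≤ w by exact_mod_cast h), zero_add,
      ENNReal.ofReal_sub _ zero_le_one]
    simp

/-- Weighted by `w`, the acceptance probabilities `min {1, r u / w}` and `min {1, r}` become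
`min {w, r u}` and `min {w, r w}`, which differ by at most `r |u - w|`. -/
lemma weight_mul_gap_le (r : ℝ≥0∞) (w u : ℝ≥0) :
    (w : ℝ≥0∞) * gap (min 1 (r * ((u : ℝ≥0∞) / w))) (min 1 r) ≤ r * gap u w := by
  have h1 : (w : ℝ≥0∞) * min 1 r = min (w : ℝ≥0∞) (r * w) := by
    rw [(mul_right_mono (a := (w : ℝ≥0∞))).map_min, mul_one, mul_comm]
  have h2 : ∀ a b : ℝ≥0∞, min (w : ℝ≥0∞) (r * a) - min (w : ℝ≥0∞) (r * b) ≤ r * (a - b) := by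
    intro a b
    rw [tsub_le_iff_left]
    rcases le_total (w : ℝ≥0∞) (r * b) with h | h
    · rw [min_eq_left h]
      exact (min_le_left _ _).trans le_self_add
    · rw [min_eq_right h, ← mul_add]
      exact (min_le_right _ _).trans (mul_le_mul_right le_add_tsub _)
  unfold gap
  rw [mul_add, ENNReal.mul_sub (fun _ _ => ENNReal.coe_ne_top),
    ENNReal.mul_sub (fun _ _ => ENNReal.coe_ne_top), weight_mul_min_ratio, h1, mul_add]
  exact add_le_add (h2 _ _) (h2 _ _)

section Pseudo

variable {X : Type*} [MeasurableSpace X] {W : Set ℝ≥0} {π : Measure X} [IsProbabilityMeasure π]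
  {q : Kernel X X} [IsMarkovKernel q] {r : X → X → ℝ≥0∞}

/-- The `L¹` hypothesis on the weights, in terms of lower integrals. -/
lemma tendsto_lintegral_gap_one {ι : Type*} {l : Filter ι} {Q : ι → Measure W}
    [∀ i, IsProbabilityMeasure (Q i)] (hQ : ∀ i, ∫⁻ w, ((w : ℝ≥0) : ℝ≥0∞) ∂(Q i) = 1)
    (h : Tendsto (fun i => ∫ w, |1 - ((w : ℝ≥0) : ℝ)| ∂(Q i)) l (𝓝 0)) :
    Tendsto (fun i => ∫⁻ w, gap 1 ((w : ℝ≥0) : ℝ≥0∞) ∂(Q i)) l (𝓝 0) := by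
  have h2 := ENNReal.tendsto_ofReal h
  rw [ENNReal.ofReal_zero] at h2
  refine h2.congr fun i => ?_
  rw [ofReal_integral_eq_lintegral_ofReal _ (ae_of_all _ fun _ => abs_nonneg _)]
  · simp_rw [gap_one_coe]
  · refine (Integrable.sub (integrable_const 1) ⟨by fun_prop, ?_⟩).abs
    rw [HasFiniteIntegral]
    simp only [Real.enorm_eq_ofReal_abs, NNReal.abs_eq, ENNReal.ofReal_coe_nnreal]
    rw [hQ i]
    exact ENNReal.one_lt_top

/-- The acceptance probabilities of the pseudo-marginal chain converge in mean to the marginal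
ones. The integrand is dominated since the weights have mean `1`. -/
lemma tendsto_lintegral_gap_ratio (hr : Measurable (Function.uncurry r)) (hrπ : IsMHRatio π q r)
    {Q : ℕ → Kernel X W} [∀ N, IsMarkovKernel (Q N)]
    (hQ : ∀ N x, ∫⁻ w, ((w : ℝ≥0) : ℝ≥0∞) ∂(Q N x) = 1)
    (hL1 : ∀ x, Tendsto (fun N => ∫ w, |1 - ((w : ℝ≥0) : ℝ)| ∂(Q N x)) atTop (𝓝 0)) :
    Tendsto (fun N => ∫⁻ p, ∫⁻ p', gap (min 1 (pseudoRatio W r p p')) (min 1 (r p.1 p'.1))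
      ∂(pseudoProposal q (Q N) p) ∂(pseudoTarget π (Q N))) atTop (𝓝 0) := by
  have hr2 : Measurable fun p : (X × W) × (X × W) => r p.1.1 p.2.1 :=
    hr.comp (f := fun p : (X × W) × (X × W) => (p.1.1, p.2.1)) (by fun_prop)
  have hG : Measurable fun p : (X × W) × (X × W) =>
      gap (min 1 (pseudoRatio W r p.1 p.2)) (min 1 (r p.1.1 p.2.1)) :=
    measurable_gap (measurable_const.min (measurable_pseudoRatio hr)) (measurable_const.min hr2)
  simp_rw [fun N => lintegral_pseudoTarget_pseudoProposal π q (Q N) hG]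
  have hfst (N : ℕ) (z : X × X) : MeasurePreserving Prod.fst ((Q N ∥ₖ Q N) z) (Q N z.1) := by
    rw [Kernel.parallelComp_apply]
    exact measurePreserving_fst
  have hsnd (N : ℕ) (z : X × X) : MeasurePreserving Prod.snd ((Q N ∥ₖ Q N) z) (Q N z.2) := by
    rw [Kernel.parallelComp_apply]
    exact measurePreserving_snd
  have hg1 : Measurable fun w : W => gap 1 ((w : ℝ≥0) : ℝ≥0∞) :=
    measurable_gap measurable_const (by fun_prop)
  have hg1' : Measurable fun s : W × W => gap 1 ((s.1 : ℝ≥0) : ℝ≥0∞) := hg1.comp measurable_fst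
  have hM : Measurable fun p : (X × X) × (W × W) => ((p.2.1 : ℝ≥0) : ℝ≥0∞) *
      gap (min 1 (pseudoRatio W r (p.1.1, p.2.1) (p.1.2, p.2.2))) (min 1 (r p.1.1 p.1.2)) := by
    refine Measurable.mul (by fun_prop) (hG.comp (f := fun p : (X × X) × (W × W) =>
      ((p.1.1, p.2.1), (p.1.2, p.2.2))) (by fun_prop))
  have h0 : (0 : ℝ≥0∞) = ∫⁻ _, 0 ∂(π ⊗ₘ q) := by simp
  rw [h0]
  refine tendsto_lintegral_of_dominated_convergence (fun _ => 2)
    (fun N => hM.lintegral_kernel_prod_right') (fun N => ae_of_all _ fun z => ?_) (by simp) ?_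
  · calc _ ≤ ∫⁻ s, ((s.1 : ℝ≥0) : ℝ≥0∞) * 2 ∂((Q N ∥ₖ Q N) z) := by
          refine lintegral_mono fun s => mul_le_mul_right ?_ _
          rw [← one_add_one_eq_two]
          exact add_le_add (tsub_le_self.trans (min_le_left _ _))
            (tsub_le_self.trans (min_le_left _ _))
      _ = 2 := by
          rw [lintegral_mul_const _ (by fun_prop),
            (hfst N z).lintegral_comp (f := fun w : W => ((w : ℝ≥0) : ℝ≥0∞)) (by fun_prop), hQ,
            one_mul]
  · have hfin : ∀ᵐ z ∂(π ⊗ₘ q), r z.1 z.2 ≠ ∞ := by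
      have h3 : Function.uncurry r =ᵐ[π ⊗ₘ q] _ := hrπ
      filter_upwards [h3, Measure.rnDeriv_ne_top ((π ⊗ₘ q).map Prod.swap) (π ⊗ₘ q)] with z hz hz'
      rwa [← hz] at hz'
    filter_upwards [hfin] with z hz
    have hlim := ENNReal.Tendsto.const_mul (a := r z.1 z.2)
      ((tendsto_lintegral_gap_one (fun N => hQ N z.1) (hL1 z.1)).add
        (tendsto_lintegral_gap_one (fun N => hQ N z.2) (hL1 z.2))) (Or.inr hz)
    rw [add_zero, mul_zero] at hlim
    refine tendsto_of_tendsto_of_tendsto_of_le_of_le tendsto_const_nhds hlim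
      (fun _ => zero_le) fun N => ?_
    calc _ ≤ ∫⁻ s, r z.1 z.2 * (gap 1 ((s.1 : ℝ≥0) : ℝ≥0∞) + gap 1 ((s.2 : ℝ≥0) : ℝ≥0∞))
          ∂((Q N ∥ₖ Q N) z) := by
          refine lintegral_mono fun s => (weight_mul_gap_le _ _ _).trans
            (mul_le_mul_right ((gap_triangle _ 1 _).trans_eq (add_comm _ _)) _)
      _ = _ := by
          rw [lintegral_const_mul' _ _ hz, lintegral_add_left hg1',
            (hfst N z).lintegral_comp hg1, (hsnd N z).lintegral_comp hg1]

/-- On functions of the first coordinate, the two kernels differ by at most the difference of the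
acceptance probabilities. -/
lemma enorm_integral_pseudoKernel_sub_le (hr : Measurable (Function.uncurry r))
    (Q : Kernel X W) [IsMarkovKernel Q] {f : X → ℝ} (hf : Measurable f) {B : ℝ}
    (hB : ∀ x, |f x| ≤ B) (p : X × W) :
    ‖∫ p', f p'.1 ∂(pseudoKernel q r hr Q p) - ∫ y, f y ∂(marginalKernel q r hr p.1)‖ₑ ≤
      (∫⁻ p', gap (min 1 (pseudoRatio W r p p')) (min 1 (r p.1 p'.1)) ∂(pseudoProposal q Q p)) *
        ENNReal.ofReal (2 * B) := by
  have hle : ∀ a : ℝ≥0∞, min 1 a ≠ ∞ := fun a =>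
    ((min_le_left _ _).trans_lt ENNReal.one_lt_top).ne
  have hle' : ∀ a : ℝ≥0∞, ‖(min 1 a).toReal‖ ≤ 1 := fun a => by
    simpa using ENNReal.toReal_mono ENNReal.one_ne_top (min_le_left 1 a)
  have hr1 : Measurable fun y => min 1 (r p.1 y) :=
    measurable_const.min (hr.comp measurable_prodMk_left)
  have hR1 : Measurable fun p' => min 1 (pseudoRatio W r p p') :=
    measurable_const.min ((measurable_pseudoRatio hr).comp measurable_prodMk_left)
  have hd (z : X × W) : |f z.1 - f p.1| ≤ 2 * B := by
    refine (abs_sub _ _).trans ?_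
    linarith [hB z.1, hB p.1]
  have hfi : Integrable (fun p' : X × W => f p'.1 - f p.1) (pseudoProposal q Q p) :=
    Integrable.of_bound ((hf.comp measurable_fst).sub_const _).aestronglyMeasurable (2 * B)
      (ae_of_all _ hd)
  have e2 : ∫ y, (min 1 (r p.1 y)).toReal * (f y - f p.1) ∂(q p.1) =
      ∫ p', (min 1 (r p.1 p'.1)).toReal * (f p'.1 - f p.1) ∂(pseudoProposal q Q p) := by
    rw [← (measurePreserving_fst_pseudoProposal q Q p).map_eq, integral_map (by fun_prop)]
    exact ((hr1.ennreal_toReal).mul (by fun_prop)).aestronglyMeasurable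
  rw [integral_mhKernel _ (f := fun p' : X × W => f p'.1) (by fun_prop) (fun z => hB z.1),
    integral_mhKernel _ hf hB, add_sub_add_left_eq_sub, e2, ← integral_sub]
  · refine (enorm_integral_le_lintegral_enorm _).trans ?_
    have hG : Measurable fun p' : X × W =>
        gap (min 1 (pseudoRatio W r p p')) (min 1 (r p.1 p'.1)) :=
      measurable_gap hR1 (hr1.comp measurable_fst)
    rw [← lintegral_mul_const _ hG]
    refine lintegral_mono fun p' => ?_
    rw [← sub_mul, enorm_mul]
    refine mul_le_mul' (enorm_toReal_sub_toReal_le_gap (hle _) (hle _)) ?_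
    rw [Real.enorm_eq_ofReal_abs]
    exact ENNReal.ofReal_le_ofReal (hd p')
  · exact hfi.bdd_mul (c := 1) hR1.ennreal_toReal.aestronglyMeasurable (ae_of_all _ fun _ => hle' _)
  · exact hfi.bdd_mul (c := 1) (hr1.comp measurable_fst).ennreal_toReal.aestronglyMeasurable
      (ae_of_all _ fun _ => hle' _)

/-- Convergence of the lagged products of bounded functions. In the inductive step the last
transition of the pseudo-marginal chain is replaced by a marginal one; by stationarity, the error
does not depend on the time at which the replacement is made. -/
lemma tendsto_integral_lag_of_bounded (hr : Measurable (Function.uncurry r))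
    (hrπ : IsMHRatio π q r) {Q : ℕ → Kernel X W} [∀ N, IsMarkovKernel (Q N)]
    (hQ : ∀ N x, ∫⁻ w, ((w : ℝ≥0) : ℝ≥0∞) ∂(Q N x) = 1)
    (hL1 : ∀ x, Tendsto (fun N => ∫ w, |1 - ((w : ℝ≥0) : ℝ)| ∂(Q N x)) atTop (𝓝 0))
    {h f : X → ℝ} (hh : Measurable h) (hf : Measurable f) {A B : ℝ} (hA : ∀ x, |h x| ≤ A)
    (hB : ∀ x, |f x| ≤ B) (k : ℕ) :
    Tendsto (fun N => ∫ ω, h (ω 0).1 * f (ω k).1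
        ∂(chainLaw (pseudoTarget π (Q N)) (pseudoKernel q r hr (Q N)))) atTop
      (𝓝 (∫ ω, h (ω 0) * f (ω k) ∂(chainLaw π (marginalKernel q r hr)))) := by
  have hprob (N : ℕ) : IsProbabilityMeasure (pseudoTarget π (Q N)) :=
    isProbabilityMeasure_pseudoTarget π (hQ N)
  have hinv (N : ℕ) := invariant_pseudoKernel hr hrπ (Q N)
  induction k generalizing f B with
  | zero =>
    have hhf : Measurable fun x => h x * f x := hh.mul hf
    refine tendsto_const_nhds.congr fun N => ?_
    have e1 := ((measurePreserving_fst_pseudoTarget π (hQ N)).comp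
      (measurePreserving_eval (hinv N) 0)).map_eq
    have e2 := (measurePreserving_eval (invariant_marginalKernel hr hrπ) 0).map_eq
    have hm0 : Measurable fun ω : ℕ → X => ω 0 := measurable_pi_apply 0
    have e3 := e2.trans e1.symm
    calc ∫ ω, h (ω 0) * f (ω 0) ∂(chainLaw π (marginalKernel q r hr))
        = ∫ x, h x * f x ∂((chainLaw π (marginalKernel q r hr)).map (fun ω => ω 0)) :=
          (integral_map hm0.aemeasurable hhf.aestronglyMeasurable).symm
      _ = _ := by
          rw [e3]
          exact integral_map (measurable_fst.comp (measurable_pi_apply 0)).aemeasurable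
            hhf.aestronglyMeasurable
  | succ k ih =>
    let T : X → ℝ := fun x => ∫ y, f y ∂(marginalKernel q r hr x)
    have hT : Measurable T := hf.stronglyMeasurable.integral_kernel.measurable
    have hbound {E : Type _} [MeasurableSpace E] (ν : Measure E) [IsProbabilityMeasure ν]
        {φ : E → ℝ} (hφ : ∀ x, |φ x| ≤ B) : |∫ y, φ y ∂ν| ≤ B := by
      simpa using norm_integral_le_of_norm_le_const (μ := ν) (f := φ) (C := B) (ae_of_all _ hφ)
    have hTB : ∀ x, |T x| ≤ B := fun x => hbound _ hB
    have ih' := ih hT hTB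
    rw [integral_mul_eval_succ hh hf hA hB]
    have hstep (N : ℕ) := integral_mul_eval_succ (μ := pseudoTarget π (Q N))
      (K := pseudoKernel q r hr (Q N)) (h := fun p : X × W => h p.1) (f := fun p => f p.1)
      (by fun_prop) (by fun_prop) (fun p => hA p.1) (fun p => hB p.1) k
    simp_rw [hstep]
    refine (add_zero (∫ ω, h (ω 0) * T (ω k) ∂(chainLaw π (marginalKernel q r hr)))) ▸ ?_
    have herr : Tendsto (fun N => ∫ ω, h (ω 0).1 *
        (∫ p', f p'.1 ∂(pseudoKernel q r hr (Q N) (ω k)) - T (ω k).1)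
        ∂(chainLaw (pseudoTarget π (Q N)) (pseudoKernel q r hr (Q N)))) atTop (𝓝 0) := by
      rw [tendsto_zero_iff_enorm_tendsto_zero]
      have hlim := ENNReal.Tendsto.const_mul (a := ENNReal.ofReal A * ENNReal.ofReal (2 * B))
        (tendsto_lintegral_gap_ratio hr hrπ hQ hL1)
        (Or.inr (ENNReal.mul_ne_top ENNReal.ofReal_ne_top ENNReal.ofReal_ne_top))
      rw [mul_zero] at hlim
      refine tendsto_of_tendsto_of_tendsto_of_le_of_le tendsto_const_nhds hlim
        (fun _ => zero_le) fun N => (enorm_integral_le_lintegral_enorm _).trans ?_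
      have hG : Measurable fun p : X × W => ∫⁻ p', gap (min 1 (pseudoRatio W r p p'))
          (min 1 (r p.1 p'.1)) ∂(pseudoProposal q (Q N) p) := by
        refine Measurable.lintegral_kernel_prod_right' (f := fun p : (X × W) × (X × W) =>
          gap (min 1 (pseudoRatio W r p.1 p.2)) (min 1 (r p.1.1 p.2.1)))
          (measurable_gap (measurable_const.min (measurable_pseudoRatio hr))
            (measurable_const.min (hr.comp (f := fun p : (X × W) × (X × W) => (p.1.1, p.2.1))
              (by fun_prop))))
      calc _ ≤ ∫⁻ ω, ENNReal.ofReal A * ENNReal.ofReal (2 * B) *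
            ∫⁻ p', gap (min 1 (pseudoRatio W r (ω k) p')) (min 1 (r (ω k).1 p'.1))
              ∂(pseudoProposal q (Q N) (ω k))
            ∂(chainLaw (pseudoTarget π (Q N)) (pseudoKernel q r hr (Q N))) := by
            refine lintegral_mono fun ω => ?_
            rw [enorm_mul, mul_assoc, mul_comm (ENNReal.ofReal (2 * B))]
            refine mul_le_mul' ?_ (enorm_integral_pseudoKernel_sub_le hr (Q N) hf hB (ω k))
            rw [Real.enorm_eq_ofReal_abs]
            exact ENNReal.ofReal_le_ofReal (hA _)
        _ = _ := by
            rw [lintegral_const_mul' _ _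
              (ENNReal.mul_ne_top ENNReal.ofReal_ne_top ENNReal.ofReal_ne_top)]
            congr 1
            exact (measurePreserving_eval (hinv N) k).lintegral_comp hG
    refine (ih'.add herr).congr fun N => ?_
    have hTm : Measurable fun p : X × W => ∫ p', f p'.1 ∂(pseudoKernel q r hr (Q N) p) :=
      ((hf.comp measurable_fst).stronglyMeasurable.integral_kernel
        (κ := pseudoKernel q r hr (Q N))).measurable
    have hint {φ : X × W → ℝ} (hφ : Measurable φ) (C : ℝ) (hC : ∀ p, |φ p| ≤ C) :
        Integrable (fun ω : ℕ → X × W => h (ω 0).1 * φ (ω k))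
          (chainLaw (pseudoTarget π (Q N)) (pseudoKernel q r hr (Q N))) := by
      refine Integrable.of_bound (Measurable.aestronglyMeasurable (by fun_prop)) (A * C)
        (ae_of_all _ fun ω => ?_)
      rw [Real.norm_eq_abs, abs_mul]
      exact mul_le_mul (hA _) (hC _) (abs_nonneg _) ((abs_nonneg _).trans (hA (ω 0).1))
    have i1 := hint (φ := fun p => T p.1) (by fun_prop) B (fun p => hTB p.1)
    have i2 := hint hTm B (fun p => hbound _ fun z : X × W => hB z.1)
    rw [← integral_add i1]
    · exact integral_congr_ae (ae_of_all _ fun ω => by ring)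
    · exact (i2.sub i1).congr (ae_of_all _ fun ω => by simp [mul_sub])

end Pseudo

/-! ### Asymptotic variance and autocorrelation series -/

lemma integral_comp_measurePreserving {Ω E : Type*} [MeasurableSpace Ω] [MeasurableSpace E]
    {P : Measure Ω} {μ : Measure E} {Y : Ω → E} (hY : MeasurePreserving Y P μ) {u : E → ℝ}
    (hu : Measurable u) : ∫ ω, u (Y ω) ∂P = ∫ x, u x ∂μ := by
  rw [← hY.map_eq]
  exact (integral_map hY.measurable.aemeasurable hu.aestronglyMeasurable).symm

section Chain

variable {E : Type*} [MeasurableSpace E] {μ : Measure E} [IsProbabilityMeasure μ]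
  {K : Kernel E E} [IsMarkovKernel K] {f : E → ℝ}

lemma memLp_eval (hK : K.Invariant μ) (hf : MemLp f 2 μ) (k : ℕ) :
    MemLp (fun ω : ℕ → E => f (ω k)) 2 (chainLaw μ K) :=
  hf.comp_measurePreserving (measurePreserving_eval hK k)

lemma integral_mul_eval_shift (hK : K.Invariant μ) (hf : Measurable f) (j k : ℕ) :
    ∫ ω, f (ω j) * f (ω (j + k)) ∂(chainLaw μ K) = lagProduct f μ K k := by
  have hff : Measurable fun z : E × E => f z.1 * f z.2 := by fun_prop
  have h (i l : ℕ) : ∫ ω, f (ω i) * f (ω l) ∂(chainLaw μ K) =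
      ∫ z, f z.1 * f z.2 ∂((chainLaw μ K).map fun ω => (ω i, ω l)) := by
    have hm : Measurable fun ω : ℕ → E => (ω i, ω l) := by fun_prop
    exact (integral_map hm.aemeasurable hff.aestronglyMeasurable).symm
  rw [lagProduct, h, h, chainLaw_map_pair_shift hK]

lemma sum_Icc_one_eq_sum_range {M : Type*} [AddCommMonoid M] (a : ℕ → M) (n : ℕ) :
    ∑ k ∈ Finset.Icc 1 n, a k = ∑ i ∈ Finset.range n, a (i + 1) := by
  induction n with
  | zero => simp
  | succ n ih => rw [Finset.sum_Icc_succ_top (by omega), ih, Finset.sum_range_succ]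

/-- The increments of `n ↦ 𝔼 (∑_{k=1}^n f(X_k))²` are the partial sums of
`c_0 + 2 ∑_{k ≥ 1} c_k`, where `c_k = 𝔼[f(X_0) f(X_k)]`. -/
lemma integral_sq_sum_succ (hK : K.Invariant μ) (hf : Measurable f) (hf2 : MemLp f 2 μ) (n : ℕ) :
    ∫ ω, (∑ i ∈ Finset.range (n + 1), f (ω (i + 1))) ^ 2 ∂(chainLaw μ K) =
      ∫ ω, (∑ i ∈ Finset.range n, f (ω (i + 1))) ^ 2 ∂(chainLaw μ K) +
        (2 * ∑ k ∈ Finset.range (n + 1), lagProduct f μ K k - lagProduct f μ K 0) := by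
  have hL := fun k => memLp_eval (K := K) hK hf2 k
  have hS : MemLp (fun ω : ℕ → E => ∑ i ∈ Finset.range n, f (ω (i + 1))) 2 (chainLaw μ K) :=
    memLp_finsetSum _ fun i _ => hL (i + 1)
  have h0 : ∫ ω, f (ω (n + 1)) ^ 2 ∂(chainLaw μ K) = lagProduct f μ K 0 := by
    simp_rw [pow_two]
    exact integral_mul_eval_shift hK hf (n + 1) 0
  have h1 : ∫ ω, (∑ i ∈ Finset.range n, f (ω (i + 1))) * f (ω (n + 1)) ∂(chainLaw μ K) =
      ∑ k ∈ Finset.range n, lagProduct f μ K (k + 1) := by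
    simp_rw [Finset.sum_mul]
    have hi (i : ℕ) : Integrable (fun ω : ℕ → E => f (ω (i + 1)) * f (ω (n + 1)))
        (chainLaw μ K) := (hL (i + 1)).integrable_mul (hL (n + 1))
    rw [integral_finsetSum _ fun i _ => hi i, ← Finset.sum_range_reflect]
    refine Finset.sum_congr rfl fun i hi => ?_
    have hi' := Finset.mem_range.1 hi
    rw [← integral_mul_eval_shift hK hf (n - 1 - i + 1) (i + 1)]
    congr! 5
    omega
  have hsplit : ∀ ω : ℕ → E, (∑ i ∈ Finset.range (n + 1), f (ω (i + 1))) ^ 2 =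
      (∑ i ∈ Finset.range n, f (ω (i + 1))) ^ 2 +
        (2 * ((∑ i ∈ Finset.range n, f (ω (i + 1))) * f (ω (n + 1))) + f (ω (n + 1)) ^ 2) := by
    intro ω
    rw [Finset.sum_range_succ]
    ring
  simp_rw [hsplit]
  have i1 := hS.integrable_sq
  have i2 : Integrable (fun ω : ℕ → E => 2 * ((∑ i ∈ Finset.range n, f (ω (i + 1))) *
    f (ω (n + 1)))) (chainLaw μ K) := (hS.integrable_mul (hL (n + 1))).const_mul 2
  have i3 := (hL (n + 1)).integrable_sq
  have i4 : Integrable (fun ω : ℕ → E => 2 * ((∑ i ∈ Finset.range n, f (ω (i + 1))) *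
    f (ω (n + 1))) + f (ω (n + 1)) ^ 2) (chainLaw μ K) := i2.add i3
  rw [integral_add i1 i4, integral_add i2 i3, integral_const_mul, h0, h1,
    Finset.sum_range_succ']
  ring

/-- If the autocorrelation series converges, to `s` say, then the asymptotic variance exists and is
`c_0 + 2 ∑_{k ≥ 1} c_k = 2 s - c_0`, by Cesàro summation. -/
lemma tendsto_scaledVar (hK : K.Invariant μ) (hf : Measurable f) (hf2 : MemLp f 2 μ) {s : ℝ}
    (hs : Tendsto (fun m : ℕ => ∑ k ∈ Finset.range m,
      lagProduct (fun x => f x - ∫ y, f y ∂μ) μ K k) atTop (𝓝 s)) :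
    Tendsto (scaledVar f μ K) atTop
      (𝓝 (ENNReal.ofReal (2 * s - lagProduct (fun x => f x - ∫ y, f y ∂μ) μ K 0))) := by
  set φ : E → ℝ := fun x => f x - ∫ y, f y ∂μ with hφ
  have hφm : Measurable φ := hf.sub_const _
  have hφ2 : MemLp φ 2 μ := hf2.sub (memLp_const _)
  have hV : ∀ n : ℕ, ∫ ω, (∑ i ∈ Finset.range n, φ (ω (i + 1))) ^ 2 ∂(chainLaw μ K) =
      ∑ i ∈ Finset.range n,
        (2 * ∑ k ∈ Finset.range (i + 1), lagProduct φ μ K k - lagProduct φ μ K 0) := by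
    intro n
    induction n with
    | zero => simp
    | succ n ih => rw [integral_sq_sum_succ hK hφm hφ2, ih, ← Finset.sum_range_succ]
  -- `2 s` counts `c_0` twice, hence the subtraction
  have hces := (((hs.comp (tendsto_add_atTop_nat 1)).const_mul 2).sub_const
    (lagProduct φ μ K 0)).cesaro
  refine (ENNReal.tendsto_ofReal hces).congr' ?_
  filter_upwards [eventually_gt_atTop 0] with n hn
  have hS : MemLp (fun ω : ℕ → E => ∑ i ∈ Finset.range n, φ (ω (i + 1))) 2 (chainLaw μ K) :=
    memLp_finsetSum _ fun i _ => memLp_eval hK hφ2 (i + 1)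
  have hn' : (0 : ℝ) < n := by exact_mod_cast hn
  have hsv : scaledVar f μ K n = (∫⁻ ω, ENNReal.ofReal
      ((∑ i ∈ Finset.range n, φ (ω (i + 1))) ^ 2) ∂(chainLaw μ K)) / n := by
    unfold scaledVar
    congr 1
    refine lintegral_congr fun ω => ?_
    rw [sum_Icc_one_eq_sum_range (fun k => f (ω k) - ∫ x, f x ∂μ)]
  rw [hsv, ← ofReal_integral_eq_lintegral_ofReal hS.integrable_sq
    (ae_of_all _ fun ω => sq_nonneg _), hV, ← ENNReal.ofReal_natCast,
    ← ENNReal.ofReal_div_of_pos hn', div_eq_inv_mul]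
  rfl

/-- Centring the function in the lagged products subtracts the square of the mean. -/
lemma lagProduct_sub_mean (hK : K.Invariant μ) (hf : Measurable f) (hf2 : MemLp f 2 μ) (k : ℕ) :
    lagProduct (fun x => f x - ∫ y, f y ∂μ) μ K k =
      lagProduct f μ K k - (∫ x, f x ∂μ) ^ 2 := by
  set m := ∫ y, f y ∂μ with hm
  have hmean (k : ℕ) : ∫ ω, f (ω k) ∂(chainLaw μ K) = m :=
    integral_comp_measurePreserving (measurePreserving_eval hK k) hf
  have hL := fun k => memLp_eval (K := K) hK hf2 k
  have hI := fun k => (hL k).integrable one_le_two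
  have i1 : Integrable (fun ω : ℕ → E => f (ω 0) * f (ω k)) (chainLaw μ K) :=
    (hL 0).integrable_mul (hL k)
  have i2 : Integrable (fun ω : ℕ → E => m * f (ω 0)) (chainLaw μ K) := (hI 0).const_mul m
  have i3 : Integrable (fun ω : ℕ → E => m * f (ω k)) (chainLaw μ K) := (hI k).const_mul m
  have hexp : ∀ ω : ℕ → E, (f (ω 0) - m) * (f (ω k) - m) =
      f (ω 0) * f (ω k) - m * f (ω 0) - m * f (ω k) + m ^ 2 := fun ω => by ring
  unfold lagProduct
  simp_rw [hexp]
  have i4 : Integrable (fun ω : ℕ → E => f (ω 0) * f (ω k) - m * f (ω 0)) (chainLaw μ K) :=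
    i1.sub i2
  have i5 : Integrable (fun ω : ℕ → E => f (ω 0) * f (ω k) - m * f (ω 0) - m * f (ω k))
    (chainLaw μ K) := i4.sub i3
  rw [integral_add i5 (integrable_const _), integral_sub i4 i3,
    integral_sub i1 i2, integral_const_mul, integral_const_mul, hmean, hmean]
  simp
  ring

/-- A finite integrated autocorrelation time gives convergence of the autocorrelation series; if
the variance vanishes, then so do all its terms. -/
lemma HasIACT.seriesConverges (hK : K.Invariant μ) (hf : Measurable f) (hf2 : MemLp f 2 μ) {τ : ℝ}
    (h : HasIACT f μ K τ) :
    SeriesConverges (lagProduct (fun x => f x - ∫ y, f y ∂μ) μ K) := by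
  set m := ∫ y, f y ∂μ with hm
  set c := lagProduct (fun x => f x - m) μ K with hc
  have hφ2 : MemLp (fun x => f x - m) 2 μ := hf2.sub (memLp_const _)
  by_cases hv : ∫ x, (f x - m) ^ 2 ∂μ = 0
  · have h0 : ∀ᵐ x ∂μ, f x - m = 0 := by
      rw [integral_eq_zero_iff_of_nonneg (fun x => sq_nonneg _) hφ2.integrable_sq] at hv
      filter_upwards [hv] with x hx
      exact pow_eq_zero_iff two_ne_zero |>.1 hx
    have hc0 : ∀ k, c k = 0 := by
      intro k
      refine integral_eq_zero_of_ae ?_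
      filter_upwards [(measurePreserving_eval hK 0).quasiMeasurePreserving.ae h0] with ω hω
      simp [hω]
    exact ⟨0, by simp [hc0]⟩
  · set v := ∫ x, (f x - m) ^ 2 ∂μ with hvdef
    have h2 := (((h.sub_const 1).div_const 2).mul_const v).add_const (c 0)
    refine ⟨_, (tendsto_add_atTop_iff_nat 1).1 (h2.congr fun n => ?_)⟩
    rw [Finset.sum_range_succ', ← sum_Icc_one_eq_sum_range, ← Finset.sum_div,
      Finset.sum_congr rfl fun k _ => (lagProduct_sub_mean hK hf hf2 k).symm]
    change (1 + 2 * ((∑ k ∈ Finset.Icc 1 n, c k) / v) - 1) / 2 * v + c 0 = _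
    field_simp
    ring

end Chain

/-! ### Truncation of square integrable functions -/

section Truncation

variable {X : Type*} [MeasurableSpace X] {π : Measure X} {φ ψ : X → ℝ}

/-- Truncation error for a product of two observations with common law `π`. The parameter `t`
comes from the inequality `|ab| ≤ (t a² + b² / t) / 2`. -/
lemma abs_integral_mul_sub_integral_mul_le {Ω : Type*} [MeasurableSpace Ω] {P : Measure Ω}
    {Y Z : Ω → X} (hY : MeasurePreserving Y P π) (hZ : MeasurePreserving Z P π)
    (hφ : Measurable φ) (hψ : Measurable ψ) (hφ2 : MemLp φ 2 π) (hψφ : ∀ x, |ψ x| ≤ |φ x|)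
    {t : ℝ} (ht : 0 < t) :
    |∫ ω, φ (Y ω) * φ (Z ω) ∂P - ∫ ω, ψ (Y ω) * ψ (Z ω) ∂P| ≤
      t * ∫ x, (φ x - ψ x) ^ 2 ∂π + (∫ x, φ x ^ 2 ∂π) / t := by
  have hψ2 : MemLp ψ 2 π := hφ2.mono hψ.aestronglyMeasurable (ae_of_all _ hψφ)
  have hφφ : Integrable (fun ω => φ (Y ω) * φ (Z ω)) P :=
    (hφ2.comp_measurePreserving hY).integrable_mul (hφ2.comp_measurePreserving hZ)
  have hψψ : Integrable (fun ω => ψ (Y ω) * ψ (Z ω)) P :=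
    (hψ2.comp_measurePreserving hY).integrable_mul (hψ2.comp_measurePreserving hZ)
  have hd : MemLp (fun x => φ x - ψ x) 2 π := hφ2.sub hψ2
  have hdY := (hd.comp_measurePreserving hY).integrable_sq
  have hdZ := (hd.comp_measurePreserving hZ).integrable_sq
  have hφY := (hφ2.comp_measurePreserving hY).integrable_sq
  have hφZ := (hφ2.comp_measurePreserving hZ).integrable_sq
  rw [← integral_sub hφφ hψψ, ← Real.norm_eq_abs]
  have i1 := (hdY.add hdZ).const_mul (t / 2)
  have i2 := (hφY.add hφZ).div_const (2 * t)
  refine (norm_integral_le_of_norm_le (i1.add i2) (ae_of_all _ fun ω => ?_)).trans_eq ?_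
  · have amgm : ∀ a b : ℝ, |a * b| ≤ t / 2 * a ^ 2 + b ^ 2 / (2 * t) := by
      intro a b
      have h : t / 2 * a ^ 2 + b ^ 2 / (2 * t) - |a| * |b| = (t * |a| - |b|) ^ 2 / (2 * t) := by
        rw [← sq_abs a, ← sq_abs b]
        field_simp
        ring
      rw [abs_mul]
      have : 0 ≤ (t * |a| - |b|) ^ 2 / (2 * t) := by positivity
      linarith
    have h1 := amgm (φ (Y ω) - ψ (Y ω)) (φ (Z ω))
    have h2 := amgm (φ (Z ω) - ψ (Z ω)) (ψ (Y ω))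
    have h3 : ψ (Y ω) ^ 2 / (2 * t) ≤ φ (Y ω) ^ 2 / (2 * t) :=
      div_le_div_of_nonneg_right (sq_le_sq.2 (hψφ _)) (by positivity)
    have h4 : φ (Y ω) * φ (Z ω) - ψ (Y ω) * ψ (Z ω) =
        (φ (Y ω) - ψ (Y ω)) * φ (Z ω) + (φ (Z ω) - ψ (Z ω)) * ψ (Y ω) := by ring
    change ‖φ (Y ω) * φ (Z ω) - ψ (Y ω) * ψ (Z ω)‖ ≤
      t / 2 * ((φ (Y ω) - ψ (Y ω)) ^ 2 + (φ (Z ω) - ψ (Z ω)) ^ 2) +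
        (φ (Y ω) ^ 2 + φ (Z ω) ^ 2) / (2 * t)
    rw [h4, Real.norm_eq_abs]
    refine (abs_add_le _ _).trans ?_
    rw [add_div]
    linarith
  · rw [integral_add' i1 i2, integral_const_mul, integral_div, integral_add' hdY hdZ,
      integral_add' hφY hφZ]
    simp only [Function.comp_apply]
    have hd2 : Measurable fun x => (φ x - ψ x) ^ 2 := by fun_prop
    rw [integral_comp_measurePreserving hY hd2, integral_comp_measurePreserving hZ hd2,
      integral_comp_measurePreserving hY (hφ.pow_const 2),
      integral_comp_measurePreserving hZ (hφ.pow_const 2)]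
    field_simp
    ring

lemma exists_bounded_approx (hφ : Measurable φ) (hφ2 : MemLp φ 2 π) {ε : ℝ} (hε : 0 < ε) :
    ∃ ψ : X → ℝ, Measurable ψ ∧ (∀ x, |ψ x| ≤ |φ x|) ∧ (∃ A : ℝ, ∀ x, |ψ x| ≤ A) ∧
      ∫ x, (φ x - ψ x) ^ 2 ∂π < ε := by
  let ψ : ℕ → X → ℝ := fun n => {x | |φ x| ≤ n}.indicator φ
  have hψm : ∀ n, Measurable (ψ n) := fun n =>
    hφ.indicator (measurableSet_le hφ.abs measurable_const)
  have hlim : Tendsto (fun n => ∫ x, (φ x - ψ n x) ^ 2 ∂π) atTop (𝓝 (∫ _, 0 ∂π)) := by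
    refine tendsto_integral_of_dominated_convergence (fun x => φ x ^ 2)
      (fun n => ((hφ.sub (hψm n)).pow_const 2).aestronglyMeasurable) hφ2.integrable_sq
      (fun n => ae_of_all _ fun x => ?_) (ae_of_all _ fun x => ?_)
    · rw [Real.norm_eq_abs, abs_of_nonneg (sq_nonneg _)]
      by_cases hx : |φ x| ≤ n
      · simp [ψ, hx, sq_nonneg]
      · simp [ψ, hx]
    · refine tendsto_const_nhds.congr' ?_
      filter_upwards [eventually_ge_atTop ⌈|φ x|⌉₊] with n hn
      have hx : |φ x| ≤ n := (Nat.le_ceil _).trans (by exact_mod_cast hn)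
      simp [ψ, hx]
  rw [integral_zero] at hlim
  obtain ⟨n, hn⟩ := (hlim.eventually_lt_const hε).exists
  refine ⟨ψ n, hψm n, fun x => ?_, ⟨n, fun x => ?_⟩, hn⟩
  · by_cases hx : |φ x| ≤ n <;> simp [ψ, hx]
  · by_cases hx : |φ x| ≤ n <;> simp [ψ, hx]

end Truncation

/-! ### Convergence of the autocorrelation series -/

section Limit

variable {X : Type*} [MeasurableSpace X] {W : Set ℝ≥0} {π : Measure X} [IsProbabilityMeasure π]
  {q : Kernel X X} [IsMarkovKernel q] {r : X → X → ℝ≥0∞}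

/-- Convergence of each lagged product, for square integrable functions: the truncation error is
uniform in `N`, since both coordinates have law `π` for every `N`. -/
lemma tendsto_lagProduct (hr : Measurable (Function.uncurry r))
    (hrπ : IsMHRatio π q r) {Q : ℕ → Kernel X W} [∀ N, IsMarkovKernel (Q N)]
    (hQ : ∀ N x, ∫⁻ w, ((w : ℝ≥0) : ℝ≥0∞) ∂(Q N x) = 1)
    (hL1 : ∀ x, Tendsto (fun N => ∫ w, |1 - ((w : ℝ≥0) : ℝ)| ∂(Q N x)) atTop (𝓝 0))
    {φ : X → ℝ} (hφ : Measurable φ) (hφ2 : MemLp φ 2 π) (k : ℕ) :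
    Tendsto (fun N => lagProduct (fun p : X × W => φ p.1) (pseudoTarget π (Q N))
      (pseudoKernel q r hr (Q N)) k) atTop (𝓝 (lagProduct φ π (marginalKernel q r hr) k)) := by
  have hprob (N : ℕ) : IsProbabilityMeasure (pseudoTarget π (Q N)) :=
    isProbabilityMeasure_pseudoTarget π (hQ N)
  rw [Metric.tendsto_atTop]
  intro ε hε
  set G := ∫ x, φ x ^ 2 ∂π with hG
  have hG0 : 0 ≤ G := integral_nonneg fun x => sq_nonneg _
  -- `t` makes the second error term smaller than `ε / 6`, and then `ψ` the first one
  obtain ⟨t, ht, htG⟩ : ∃ t : ℝ, 0 < t ∧ G / t < ε / 6 := by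
    refine ⟨6 * (G + 1) / ε, by positivity, ?_⟩
    rw [div_lt_iff₀ (by positivity)]
    field_simp
    linarith
  obtain ⟨ψ, hψ, hψφ, ⟨A, hA⟩, hψε⟩ := exists_bounded_approx hφ hφ2
    (show 0 < ε / (6 * t) by positivity)
  have herr : t * ∫ x, (φ x - ψ x) ^ 2 ∂π + G / t < ε / 3 := by
    have h1 := mul_lt_mul_of_pos_left hψε ht
    have h2 : t * (ε / (6 * t)) = ε / 6 := by field_simp
    linarith
  have hev := fun k => measurePreserving_eval (invariant_marginalKernel hr hrπ) k
  have hevN := fun N k => (measurePreserving_fst_pseudoTarget π (hQ N)).comp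
    (measurePreserving_eval (invariant_pseudoKernel hr hrπ (Q N)) k)
  obtain ⟨N₁, hN₁⟩ := Metric.tendsto_atTop.1
    (tendsto_integral_lag_of_bounded hr hrπ hQ hL1 hψ hψ hA hA k) (ε / 3) (by positivity)
  refine ⟨N₁, fun N hN => ?_⟩
  have e1 := abs_integral_mul_sub_integral_mul_le (hev 0) (hev k) hφ hψ hφ2 hψφ ht
  have e2 := abs_integral_mul_sub_integral_mul_le (hevN N 0) (hevN N k) hφ hψ hφ2 hψφ ht
  have e3 := hN₁ N hN
  simp only [Function.comp_apply] at e2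
  rw [Real.dist_eq, abs_lt] at e3
  rw [Real.dist_eq, abs_lt]
  have e1' := abs_lt.1 (e1.trans_lt herr)
  have e2' := abs_lt.1 (e2.trans_lt herr)
  unfold lagProduct
  constructor <;> linarith [e1'.1, e1'.2, e2'.1, e2'.2, e3.1, e3.2]

lemma seriesTail_eq {c : ℕ → ℝ} {s : ℝ}
    (h : Tendsto (fun m : ℕ => ∑ k ∈ Finset.range m, c k) atTop (𝓝 s)) (n : ℕ) :
    seriesTail c n = s - ∑ k ∈ Finset.range n, c k := by
  refine Tendsto.limUnder_eq ((h.sub_const _).congr' ?_)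
  filter_upwards [eventually_ge_atTop n] with m hm
  exact (Finset.sum_Ico_eq_sub c hm).symm

/-- Termwise convergence and uniformly small tails give convergence of the sums. -/
lemma tendsto_sum_of_uniform_tail {c : ℕ → ℕ → ℝ} {c' s : ℕ → ℝ} {s' : ℝ} {N₀ : ℕ}
    (hc : ∀ k, Tendsto (fun N => c N k) atTop (𝓝 (c' k)))
    (hs : ∀ N ≥ N₀, Tendsto (fun m : ℕ => ∑ k ∈ Finset.range m, c N k) atTop (𝓝 (s N)))
    (hs' : Tendsto (fun m : ℕ => ∑ k ∈ Finset.range m, c' k) atTop (𝓝 s'))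
    (htail : Tendsto (fun n : ℕ => ⨆ N ≥ N₀, ENNReal.ofReal |seriesTail (c N) n|) atTop (𝓝 0)) :
    Tendsto s atTop (𝓝 s') := by
  rw [Metric.tendsto_atTop]
  intro ε hε
  have h3 : 0 < ε / 3 := by positivity
  obtain ⟨n, hn1, hn2⟩ := ((htail.eventually_lt_const (ENNReal.ofReal_pos.2 h3)).and
    (Metric.tendsto_nhds.1 hs' (ε / 3) h3)).exists
  obtain ⟨N₁, hN₁⟩ := Metric.tendsto_atTop.1
    (tendsto_finsetSum (Finset.range n) fun k _ => hc k) (ε / 3) h3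
  refine ⟨max N₀ N₁, fun N hN => ?_⟩
  have hN0 : N ≥ N₀ := (le_max_left _ _).trans hN
  have t1 := hN₁ N ((le_max_right _ _).trans hN)
  have t2 : |seriesTail (c N) n| < ε / 3 := by
    refine (ENNReal.ofReal_lt_ofReal_iff h3).1 (lt_of_le_of_lt ?_ hn1)
    exact le_iSup₂ (f := fun N (_ : N ≥ N₀) => ENNReal.ofReal |seriesTail (c N) n|) N hN0
  rw [seriesTail_eq (hs N hN0), abs_lt] at t2
  rw [Real.dist_eq, abs_lt] at t1 hn2 ⊢
  constructor <;> linarith [t1.1, t1.2, t2.1, t2.2, hn2.1, hn2.2]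

end Limit

end PseudoMarginal

theorem mainTheorem4 {X : Type*} [MeasurableSpace X]
    -- the target distribution and the proposal kernel
    (π : Measure X) [IsProbabilityMeasure π] (q : Kernel X X) [IsMarkovKernel q]
    -- a version of the Metropolis-Hastings ratio
    (r : X → X → ℝ≥0∞) (hr : Measurable (Function.uncurry r)) (hrπ : IsMHRatio π q r)
    -- the weight space and the weight distributions, non-negative and of unit mean
    (W : Set ℝ≥0) (_hW : MeasurableSet W)
    (Q : ℕ → Kernel X W) [∀ N, IsMarkovKernel (Q N)]
    (hQ : ∀ N x, ∫⁻ w, ((w : ℝ≥0) : ℝ≥0∞) ∂(Q N x) = 1)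
    -- the test function
    (g : X → ℝ) (hg : Measurable g) (δ : ℝ) (hδ : 0 < δ)
    (hgδ : Integrable (fun x => |g x| ^ (2 + δ)) π)
    (hcond : UniformAutocorrTails π q r hr Q g)
    (hL1 : ∀ x, Tendsto (fun N => ∫ w, |1 - ((w : ℝ≥0) : ℝ)| ∂(Q N x)) atTop (𝓝 0)) :
    -- the asymptotic variances exist (the marginal one is finite) and converge
    AsympVarExists g π (marginalKernel q r hr) ∧
    asympVar g π (marginalKernel q r hr) ≠ ∞ ∧
    (∀ᶠ N in atTop, AsympVarExists (fun p : X × W => g p.1) (pseudoTarget π (Q N))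
      (pseudoKernel q r hr (Q N))) ∧
    Tendsto (fun N => asympVar (fun p : X × W => g p.1) (pseudoTarget π (Q N))
      (pseudoKernel q r hr (Q N))) atTop (𝓝 (asympVar g π (marginalKernel q r hr))) := by
  obtain ⟨⟨τ, hτ⟩, N₀, hconv, htail⟩ := hcond
  have hprob (N : ℕ) : IsProbabilityMeasure (pseudoTarget π (Q N)) :=
    isProbabilityMeasure_pseudoTarget π (hQ N)
  have hfst (N : ℕ) := measurePreserving_fst_pseudoTarget π (hQ N)
  have hinv := invariant_marginalKernel hr hrπ
  have hinvN (N : ℕ) := invariant_pseudoKernel hr hrπ (Q N)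
  have hg2 : MemLp g 2 π := by
    have hp : ENNReal.ofReal (2 + δ) ≠ 0 := (ENNReal.ofReal_pos.2 (by linarith)).ne'
    have h := (integrable_norm_rpow_iff hg.aestronglyMeasurable hp ENNReal.ofReal_ne_top).1
      (by simpa [ENNReal.toReal_ofReal (show 0 ≤ 2 + δ by linarith)] using hgδ)
    refine h.mono_exponent ?_
    rw [← ENNReal.ofReal_ofNat]
    exact ENNReal.ofReal_le_ofReal (by linarith)
  set m := ∫ x, g x ∂π with hm
  set c : ℕ → ℕ → ℝ := fun N => lagProduct (fun p : X × W => g p.1 - m)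
    (pseudoTarget π (Q N)) (pseudoKernel q r hr (Q N)) with hc
  set c' : ℕ → ℝ := lagProduct (fun x => g x - m) π (marginalKernel q r hr) with hc'
  have hlag (k : ℕ) : Tendsto (fun N => c N k) atTop (𝓝 (c' k)) :=
    tendsto_lagProduct hr hrπ hQ hL1 (φ := fun x => g x - m) (hg.sub_const m)
      (hg2.sub (memLp_const m)) k
  obtain ⟨s', hs'⟩ := hτ.seriesConverges hinv hg hg2
  choose! s hs using hconv
  have hvar := tendsto_scaledVar hinv hg hg2 hs'
  have hvarN (N : ℕ) (hN : N ≥ N₀) : Tendsto (scaledVar (fun p : X × W => g p.1)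
      (pseudoTarget π (Q N)) (pseudoKernel q r hr (Q N))) atTop
      (𝓝 (ENNReal.ofReal (2 * s N - c N 0))) := by
    have hmean : ∫ p : X × W, g p.1 ∂(pseudoTarget π (Q N)) = m :=
      integral_comp_measurePreserving (hfst N) hg
    have h := tendsto_scaledVar (f := fun p : X × W => g p.1) (s := s N) (hinvN N)
      (hg.comp measurable_fst) (hg2.comp_measurePreserving (hfst N))
    simp only [hmean] at h
    exact h (hs N hN)
  refine ⟨⟨_, hvar⟩, ?_, ?_, ?_⟩
  · rw [asympVar, hvar.limUnder_eq]
    exact ENNReal.ofReal_ne_top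
  · filter_upwards [eventually_ge_atTop N₀] with N hN
    exact ⟨_, hvarN N hN⟩
  · rw [asympVar, hvar.limUnder_eq]
    have hsum := tendsto_sum_of_uniform_tail hlag hs hs' htail
    refine (ENNReal.tendsto_ofReal ((hsum.const_mul 2).sub (hlag 0))).congr' ?_
    filter_upwards [eventually_ge_atTop N₀] with N hN
    exact (hvarN N hN).limUnder_eq.symm
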